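/- Let $g\ge 2$, let $g_1,\dots,g_{2g}$ be $2g$ distinct symbols with the fixed-point-free involution $a\mapsto a^{-1}$ given by $g_{i+g}=g_i^{-1}$ for $1\le i\le g$, and let $$\mathcal S=\{(a_k)_{k\in\mathbb Z}\;:\;a_k\in\{g_1,\dots,g_{2g}\},\ a_{k+1}\ne a_k^{-1}\ \text{for all }k\}$$ with the product topology, $T:\mathcal S\to\mathcal S$, $(Tx)_k=x_{k+1}$, the two-sided shift, and $\mathcal S_T=\mathcal S\times[0,1]/(x,0)\sim(Tx,1)$ its mapping torus. Extend $[x,t]$ to all $t\in\mathbb R$ by $[x,t]=[T^{-n}x,t-n]$, $n=\lfloor t\rfloor$. If $T^Nx=x$ with $N\ge 1$, let $c_{x,N}:\mathbb R/\mathbb Z\to\mathcal S_T$, $t\mapsto[x,Nt]$, and let $[c_{x,N}]\in H_1(\mathcal S_T,\mathbb Z)$ (singular homology) be the image of a fixed generator of $H_1(\mathbb R/\mathbb Z,\mathbb Z)\cong\mathbb Z$. Let $\mathcal S^p\subset\mathcal S$ be the set of periodic points of $T$. (1) For $N\ge 0$ let $\mathcal K_N$ be the free abelian group on the reduced words $a_0\dots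 a_N$ of length $N+1$ with $a_N\ne a_0^{-1}$. Then $$\operatorname{rank}\mathcal K_N=\begin{cases}(2g-1)^{N+1}+1,& N\text{ even},\\ (2g-1)^{N+1}+(2g-1),& N\text{ odd}.\end{cases}$$ Whenever $M+1=k(N+1)$ let $J_k:\mathcal K_N\to\mathcal K_M$ repeat each word $k$ times. With respect to these maps (indices ordered by divisibility of the lengths $N+1$) there is an isomorphism of abelian groups $$H_1(\mathcal S_T,\mathbb Z)\cong\varinjlim_N\mathcal K_N,$$ and each $\mathcal K_N\to\varinjlim_N\mathcal K_N$ is injective. Moreover, if $\kappa_N:\mathcal K_N\to H_1(\mathcal S_T,\mathbb Z)$ sends a word $a_0\dots a_N$ to $[c_{x,N+1}]$, where $x=\overline{a_0\dots a_N}$ is its periodic repetition, then the images of all the $\kappa_N$ together generate $H_1(\mathcal S_T,\mathbb Z)$, and $\kappa_M\circ J_k=k\,\kappa_N$ whenever $M+1=k(N+1)$. (2) For $N\ge 0$ let $\mathcal R_N\subset H_1(\mathcal S_T,\mathbb Z)$ be the subgroup generated by the classes $[c_{x,N}]$ of the $x\in\mathcal S^p$ of exact period $N$ (so $\mathcal R_0=0$).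 Then $$H_1(\mathcal S_T,\mathbb Z)=\bigoplus_{N=0}^\infty\mathcal R_N,$$ each $\mathcal R_N$ is free abelian of finite rank $R_N$, and $$R_1=2g,\qquad R_2=2g(g-1),\qquad R_N=\frac1N\sum_{d\mid N}\mu(d)\,(2g-1)^{N/d}\quad(N\ge 3),$$ with $\mu$ the Möbius function. (3) The set $\mathcal S^p/T$ of periodic orbits is countably infinite and $H_1(\mathcal S_T,\mathbb Z)$ is the free abelian group $\mathbb Z\langle\mathcal S^p/T\rangle$: the classes $[c_{x,N}]$, one for each orbit (with $N$ the exact period of $x$), form a $\mathbb Z$-basis. -/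

import Mathlib

open CategoryTheory

noncomputable section

namespace SchottkyShift

/-! ### Reduced sequences and the shift -/

/-- The `2g` letters: `(i, true)` stands for the generator `g_i`, `(i, false)` for `g_i⁻¹`. -/
abbrev Letter (g : ℕ) : Type := Fin g × Bool

/-- The formal inverse of a letter. -/
def Letter.inv {g : ℕ} (a : Letter g) : Letter g := (a.1, !a.2)

/-- The space `𝒮` of doubly infinite reduced sequences, with the topology induced by the product
topology on `ℤ → Letter g` (each factor is finite and discrete). -/
abbrev Seq (g : ℕ) : Type := {x : ℤ → Letter g // ∀ k, x (k + 1) ≠ (x k).inv}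

/-- The two-sided shift `T`, `(T x)_k = x_{k+1}`, as a homeomorphism of `𝒮`. -/
def shift (g : ℕ) : Seq g ≃ₜ Seq g where
  toFun x := ⟨fun k => x.1 (k + 1), fun k => x.2 (k + 1)⟩
  invFun x := ⟨fun k => x.1 (k - 1), fun k => by
    have h := x.2 (k - 1)
    rwa [show k - 1 + 1 = k + 1 - 1 by ring] at h⟩
  left_inv x := by ext1; funext k; simp
  right_inv x := by ext1; funext k; simp
  continuous_toFun := by
    refine Continuous.subtype_mk (continuous_pi fun k => ?_) _
    exact (continuous_apply (k + 1)).comp continuous_subtype_val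
  continuous_invFun := by
    refine Continuous.subtype_mk (continuous_pi fun k => ?_) _
    exact (continuous_apply (k - 1)).comp continuous_subtype_val

/-- The set `𝒮^p` of periodic points of the shift. -/
abbrev PeriodicSeq (g : ℕ) : Type := {x : Seq g // x ∈ Function.periodicPts (shift g)}

/-- Two periodic sequences are equivalent when they lie on the same orbit of `T`. -/
def periodicSetoid (g : ℕ) : Setoid (PeriodicSeq g) :=
  (Equiv.Perm.SameCycle.setoid (shift g).toEquiv).comap Subtype.val

/-- The set `𝒮^p / T` of periodic orbits. -/
def PeriodicOrbit (g : ℕ) : Type := Quotient (periodicSetoid g)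

/-- The orbit of a periodic sequence. -/
def PeriodicSeq.orbit {g : ℕ} (x : PeriodicSeq g) : PeriodicOrbit g :=
  Quotient.mk (periodicSetoid g) x

/-! ### The mapping torus -/

/-- The identification `(x, 0) ∼ (T x, 1)` on `𝒮 × [0, 1]`. -/
def torusRel (g : ℕ) (p q : Seq g × unitInterval) : Prop :=
  p.2 = 0 ∧ q.2 = 1 ∧ q.1 = shift g p.1

/-- The mapping torus `𝒮_T = 𝒮 × [0, 1] / (x, 0) ∼ (T x, 1)`: the quotient by the equivalence
relation generated by `torusRel`. -/
def MappingTorus (g : ℕ) : Type := Quot (torusRel g)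

/-- The quotient topology. -/
instance (g : ℕ) : TopologicalSpace (MappingTorus g) :=
  inferInstanceAs (TopologicalSpace (Quot (torusRel g)))

/-- The class `[x, t]` of a point of `𝒮 × [0, 1]`. -/
def MappingTorus.mk {g : ℕ} (x : Seq g) (t : unitInterval) : MappingTorus g :=
  Quot.mk _ (x, t)

theorem MappingTorus.mk_zero {g : ℕ} (x : Seq g) :
    MappingTorus.mk x 0 = MappingTorus.mk (shift g x) 1 :=
  Quot.sound ⟨rfl, rfl, rfl⟩

theorem MappingTorus.continuous_mk {g : ℕ} :
    Continuous fun p : Seq g × unitInterval => MappingTorus.mk p.1 p.2 :=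
  continuous_quot_mk

/-- The powers `T ^ n`, `n ∈ ℤ`, of the shift: `(T ^ n x)_k = x_{k+n}`. -/
def shiftPow {g : ℕ} (n : ℤ) (x : Seq g) : Seq g :=
  ⟨fun k => x.1 (k + n), fun k => by
    have h := x.2 (k + n)
    rwa [show k + n + 1 = k + 1 + n by ring] at h⟩

/-- `shiftPow` is the integer power of the shift. -/
theorem shiftPow_eq {g : ℕ} (n : ℤ) (x : Seq g) :
    shiftPow n x = ((shift g).toEquiv ^ n : Equiv.Perm (Seq g)) x := by
  induction n using Int.induction_on generalizing x with
  | zero => ext1; funext k; simp [shiftPow]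
  | succ n ih =>
    rw [zpow_add_one, Equiv.Perm.mul_apply, ← ih]
    ext1; funext k
    change x.1 (k + (n + 1)) = x.1 (k + n + 1)
    exact congrArg x.1 (by ring)
  | pred n ih =>
    rw [zpow_sub_one, Equiv.Perm.mul_apply, ← ih]
    ext1; funext k
    change x.1 (k + (-n - 1)) = x.1 (k + -n - 1)
    exact congrArg x.1 (by ring)

/-- The line `t ↦ [x, t]`, `t ∈ ℝ`, in the mapping torus. The identification
`(x, 0) ∼ (T x, 1)` extends `[x, t]` from `0 ≤ t ≤ 1` to all `t` by
`[x, t] = [T ^ (-n) x, t - n]` with `n = ⌊t⌋`. -/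
def line {g : ℕ} (x : Seq g) (t : ℝ) : MappingTorus g :=
  MappingTorus.mk (shiftPow (-⌊t⌋) x) ⟨Int.fract t, Int.fract_nonneg t, (Int.fract_lt_one t).le⟩

theorem line_eq_of_mem {g : ℕ} (x : Seq g) (n : ℤ) (t : ℝ) (ht : t ∈ Set.Icc (n : ℝ) (n + 1)) :
    line x t = MappingTorus.mk (shiftPow (-n) x)
      ⟨t - n, by linarith [ht.1], by linarith [ht.2]⟩ := by
  rcases lt_or_eq_of_le ht.2 with h | h
  · have hf : ⌊t⌋ = n := Int.floor_eq_iff.2 ⟨ht.1, h⟩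
    subst hf
    rfl
  · have hf : ⌊t⌋ = n + 1 := by rw [h]; exact_mod_cast Int.floor_intCast (n + 1)
    have h0 : (⟨Int.fract t, Int.fract_nonneg t, (Int.fract_lt_one t).le⟩ : unitInterval) = 0 := by
      apply Subtype.ext
      change Int.fract t = 0
      rw [Int.fract, hf, h]; push_cast; ring
    have h1 : (⟨t - n, by linarith [ht.1], by linarith [ht.2]⟩ : unitInterval) = 1 := by
      apply Subtype.ext
      change t - n = 1
      rw [h]; ring
    rw [line, h0, h1, hf, MappingTorus.mk_zero]
    congr 1
    ext1; funext k
    change x.1 (k + 1 + -(n + 1)) = x.1 (k + -n)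
    exact congrArg x.1 (by ring)

theorem continuous_line {g : ℕ} (x : Seq g) : Continuous (line x) := by
  have hlf : LocallyFinite fun n : ℤ => Set.Icc (n : ℝ) (n + 1) := by
    intro t
    refine ⟨Set.Ioo (t - 1) (t + 1), Ioo_mem_nhds (by linarith) (by linarith), ?_⟩
    refine (Set.finite_Icc (⌊t⌋ - 2) (⌊t⌋ + 2)).subset ?_
    rintro n ⟨s, hs, hs'⟩
    have h1 := Int.floor_le t
    have h2 := Int.lt_floor_add_one t
    simp only [Set.mem_Icc, Set.mem_Ioo] at *
    constructor
    · have : ((⌊t⌋ - 2 : ℤ) : ℝ) < n := by push_cast; linarith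
      exact_mod_cast this.le
    · have : (n : ℝ) < ((⌊t⌋ + 2 : ℤ) : ℝ) := by push_cast; linarith
      exact_mod_cast this.le
  refine hlf.continuous ?_ (fun n => isClosed_Icc) ?_
  · refine Set.eq_univ_of_forall fun t => Set.mem_iUnion.2 ⟨⌊t⌋, Int.floor_le t, ?_⟩
    exact (Int.lt_floor_add_one t).le
  · intro n
    rw [continuousOn_iff_continuous_domRestrict]
    have : (Set.Icc (n : ℝ) (n + 1)).domRestrict (line x) = fun t =>
        MappingTorus.mk (shiftPow (-n) x)
          ⟨t.1 - n, by linarith [t.2.1], by linarith [t.2.2]⟩ := by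
      funext t; exact line_eq_of_mem x n t.1 t.2
    rw [this]
    refine (MappingTorus.continuous_mk (g := g)).comp (continuous_const.prodMk ?_)
    exact Continuous.subtype_mk (continuous_subtype_val.sub continuous_const) _

theorem shiftPow_neg_of_iterate {g : ℕ} (x : Seq g) (N : ℕ) (h : (shift g)^[N] x = x) :
    shiftPow (-(N : ℤ)) x = x := by
  have h' : ((shift g).toEquiv ^ (N : ℤ) : Equiv.Perm (Seq g)) x = x := by
    rw [zpow_natCast, Equiv.Perm.coe_pow]
    exact h
  rw [shiftPow_eq, zpow_neg]
  exact Equiv.Perm.inv_eq_iff_eq.2 h'.symm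

theorem line_add_period {g : ℕ} (x : Seq g) (N : ℕ) (h : (shift g)^[N] x = x) (t : ℝ) :
    line x (t + N) = line x t := by
  have hx := shiftPow_neg_of_iterate x N h
  have hs : shiftPow (-⌊t + N⌋) x = shiftPow (-⌊t⌋) x := by
    conv_rhs => rw [← hx]
    ext1; funext k
    change x.1 (k + -⌊t + N⌋) = x.1 (k + -⌊t⌋ + -N)
    exact congrArg x.1 (by rw [Int.floor_add_natCast]; ring)
  unfold line
  rw [hs]
  congr 2
  exact Int.fract_add_natCast t N

/-- For `T ^ N x = x`, the closed curve `c_x : ℝ / ℤ → 𝒮_T`, `t ↦ [x, N t]`. -/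
def closedCurve {g : ℕ} (x : Seq g) (N : ℕ) (h : (shift g)^[N] x = x) :
    C(UnitAddCircle, MappingTorus g) where
  toFun := Function.Periodic.lift (f := fun t : ℝ => line x (N * t)) (c := (1 : ℝ)) fun t => by
    change line x (N * (t + 1)) = _
    rw [mul_add, mul_one]
    exact line_add_period x N h _
  continuous_toFun := by
    refine continuous_coinduced_dom.2 ?_
    exact (continuous_line x).comp (continuous_const.mul continuous_id)

/-! ### First homology -/

/-- First singular homology with integer coefficients. -/
abbrev H₁ (X : Type) [TopologicalSpace X] : ModuleCat.{0} ℤ :=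
  ((AlgebraicTopology.singularHomologyFunctor (ModuleCat.{0} ℤ) 1).obj (ModuleCat.of ℤ ℤ)).obj
    (TopCat.of X)

/-- The map induced on first homology by a continuous map. -/
def H₁.map {X Y : Type} [TopologicalSpace X] [TopologicalSpace Y] (f : C(X, Y)) :
    H₁ X →ₗ[ℤ] H₁ Y :=
  (((AlgebraicTopology.singularHomologyFunctor (ModuleCat.{0} ℤ) 1).obj
    (ModuleCat.of ℤ ℤ)).map (TopCat.ofHom f)).hom

/-- The homology class of `c_x : t ↦ [x, N t]`, where `T ^ N x = x`, with respect to a chosen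
class `ε` of the circle. -/
def curveClass {g : ℕ} (ε : H₁ UnitAddCircle) (x : Seq g) (N : ℕ) (h : (shift g)^[N] x = x) :
    H₁ (MappingTorus g) :=
  H₁.map (closedCurve x N h) ε

/-- The homology class of the closed orbit through a periodic sequence `x`, run through once. -/
def orbitClass {g : ℕ} (ε : H₁ UnitAddCircle) (x : PeriodicSeq g) : H₁ (MappingTorus g) :=
  curveClass ε x.1 (Function.minimalPeriod (shift g) x.1) Function.iterate_minimalPeriod

/-- `ℛ_N`: the subgroup of `H₁(𝒮_T, ℤ)` generated by the closed orbits through the periodic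
sequences of exact (primitive) period `N`. -/
def primitivePart {g : ℕ} (ε : H₁ UnitAddCircle) (N : ℕ) :
    Submodule ℤ (H₁ (MappingTorus g)) :=
  Submodule.span ℤ
    {c | ∃ x : PeriodicSeq g, Function.minimalPeriod (shift g) x.1 = N ∧ c = orbitClass ε x}

/-! ### Cyclically reduced words and their direct system -/

/-- Reduced words `a_0 … a_N` of length `N + 1` with `a_N ≠ a_0⁻¹`. The positions `0, …, N` are
taken modulo `N + 1`, so that the condition at `i = N` is `a_0 ≠ a_N⁻¹`. -/
abbrev CyclicWord (g N : ℕ) : Type :=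
  {a : ZMod (N + 1) → Letter g // ∀ i, a (i + 1) ≠ (a i).inv}

/-- `𝒦_N`: the free abelian group on the words `a_0 … a_N` with `a_N ≠ a_0⁻¹`. -/
abbrev WordGroup (g N : ℕ) : Type := CyclicWord g N →₀ ℤ

/-- If `M + 1 = k (N + 1)`, the word `a_0 … a_N` repeated `k` times. -/
def CyclicWord.rep {g N M : ℕ} (h : N + 1 ∣ M + 1) (a : CyclicWord g N) : CyclicWord g M :=
  ⟨fun i => a.1 (ZMod.castHom h (ZMod (N + 1)) i), fun i => by
    simpa only [map_add, map_one] using a.2 (ZMod.castHom h (ZMod (N + 1)) i)⟩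

/-- The homomorphism `J_k : 𝒦_N → 𝒦_M`, `M + 1 = k (N + 1)`, repeating each word `k` times. -/
def J (g : ℕ) {N M : ℕ} (h : N + 1 ∣ M + 1) : WordGroup g N →ₗ[ℤ] WordGroup g M :=
  Finsupp.lmapDomain ℤ ℤ (CyclicWord.rep h)

/-- The index set `ℕ` of the groups `𝒦_N`, ordered by divisibility of the lengths `N + 1`. -/
structure LengthIndex : Type where
  /-- The index `N`. -/
  idx : ℕ
  deriving DecidableEq

instance : Preorder LengthIndex where
  le N M := N.idx + 1 ∣ M.idx + 1
  le_refl _ := dvd_rfl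
  le_trans _ _ _ := dvd_trans

/-- The direct limit of the groups `𝒦_N` along the maps `J_k`. -/
abbrev WordLimit (g : ℕ) : Type :=
  Module.DirectLimit (fun N : LengthIndex => WordGroup g N.idx)
    fun _ _ (h : _ ≤ _) => J g h

/-- The canonical homomorphism from `𝒦_N` to the direct limit. -/
def WordGroup.toLimit (g N : ℕ) : WordGroup g N →ₗ[ℤ] WordLimit g :=
  Module.DirectLimit.of ℤ LengthIndex (fun N : LengthIndex => WordGroup g N.idx)
    (fun _ _ (h : _ ≤ _) => J g h) ⟨N⟩

/-- The periodic doubly infinite sequence obtained by repeating a word. -/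
def CyclicWord.periodic {g N : ℕ} (a : CyclicWord g N) : Seq g :=
  ⟨fun k => a.1 (k : ZMod (N + 1)), fun k => by push_cast; exact a.2 _⟩

theorem shift_iterate_apply {g : ℕ} (n : ℕ) (x : Seq g) (k : ℤ) :
    ((shift g)^[n] x).1 k = x.1 (k + n) := by
  induction n generalizing x with
  | zero => simp
  | succ n ih =>
    rw [Function.iterate_succ_apply, ih]
    change x.1 (k + n + 1) = x.1 (k + (n + 1 : ℕ))
    exact congrArg x.1 (by push_cast; ring)

theorem CyclicWord.iterate_periodic {g N : ℕ} (a : CyclicWord g N) :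
    (shift g)^[N + 1] a.periodic = a.periodic := by
  ext1; funext k
  rw [shift_iterate_apply]
  have : ((N + 1 : ℕ) : ZMod (N + 1)) = 0 := ZMod.natCast_self _
  change a.1 ((k + (N + 1 : ℕ) : ℤ) : ZMod (N + 1)) = a.1 (k : ZMod (N + 1))
  exact congrArg a.1 (by rw [Int.cast_add, Int.cast_natCast, this, add_zero])

/-- The homomorphism `𝒦_N → H₁(𝒮_T, ℤ)` sending a word `a_0 … a_N` to the class of
`c_x : t ↦ [x, (N + 1) t]`, where `x` is the periodic sequence with period `a_0 … a_N`. -/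
def WordGroup.toH₁ {g : ℕ} (ε : H₁ UnitAddCircle) (N : ℕ) :
    WordGroup g N →ₗ[ℤ] H₁ (MappingTorus g) :=
  Finsupp.linearCombination ℤ fun a : CyclicWord g N =>
    curveClass ε a.periodic (N + 1) a.iterate_periodic

end SchottkyShift

end

/-! The map `(x, t) ↦ [x, t]` from `Seq g × ℝ` to the mapping torus is the quotient by a free
ℤ-action, hence a covering (`isCoveringMap_line`). A singular simplex lifts to `Seq g × ℝ`, and
since `Seq g` is totally disconnected its first coordinate is constant. So every simplex lies on a
single line, and singular chains see only a disjoint union of orbits: a circle for each periodic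
one, a real line for each of the others. `IsLineSystem` isolates this property, and the homology is
computed from it alone.

Generation (`classOf_mem_span`): measuring each point from an origin on its orbit shows that a
one-chain is determined, modulo boundaries and closed orbits, by its endpoints. Independence
(`exists_dual`): signed length along each orbit is a cocycle, whose value on a closed orbit is its
period. The same computation for the circle, a single line with trivial permutation, yields the
generator `ε`.

The periodic orbits are thus a basis, and grouping them by exact period gives the `primitivePart`
decomposition. Ranks come from counting: points fixed by the `n`-th iterate are cyclic words, their
number is the trace of a power of the transition matrix, and Möbius inversion extracts the orbits.

The maps `J` carry basis words to basis words, so the direct limit is free on periodic sequences,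
not on orbits. The isomorphism with homology is therefore not induced by the maps `WordGroup.toH₁`,
which acquire a factor `k` under `J`; it exists because both groups are free of countably infinite
rank. -/

noncomputable section

open CategoryTheory AlgebraicTopology Simplicial

/-! ### Singular chains, and one-chains modulo boundaries -/

namespace SingularChains

/-- The integral singular chain complex. -/
abbrev complex (X : Type) [TopologicalSpace X] : ChainComplex (ModuleCat.{0} ℤ) ℕ :=
  (TopCat.toSSet.obj (TopCat.of X)).chainComplex (ModuleCat.of ℤ ℤ)

/-- The group of singular `n`-chains. -/
abbrev Chain (X : Type) [TopologicalSpace X] (n : ℕ) : ModuleCat.{0} ℤ := (complex X).X n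

/-- The boundary map on singular chains. -/
abbrev bd (X : Type) [TopologicalSpace X] (m n : ℕ) : Chain X m →ₗ[ℤ] Chain X n :=
  ((complex X).d m n).hom

/-- Singular `n`-simplices. -/
abbrev Simplex (X : Type) [TopologicalSpace X] (n : ℕ) := C(stdSimplex ℝ (Fin (n + 1)), X)

variable {X Y : Type} [TopologicalSpace X] [TopologicalSpace Y] {n : ℕ}

/-- The simplex of the singular simplicial set given by a continuous map. -/
def toSSetSimplex (σ : Simplex X n) : (TopCat.toSSet.obj (TopCat.of X)) _⦋n⦌ :=
  ((TopCat.of X).toSSetObjEquiv (.op ⦋n⦌)).symm σ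

/-- The basic chain of a singular simplex. -/
def single (σ : Simplex X n) : Chain X n :=
  ((TopCat.toSSet.obj (TopCat.of X)).ιChainComplex (R := ModuleCat.of ℤ ℤ) (toSSetSimplex σ)).hom
    (1 : ℤ)

/-- The inclusion of the `i`-th face of the standard simplex. -/
def faceMap (n : ℕ) (i : Fin (n + 2)) :
    C(stdSimplex ℝ (Fin (n + 1)), stdSimplex ℝ (Fin (n + 2))) :=
  ⟨stdSimplex.map i.succAbove, stdSimplex.continuous_map _⟩

theorem toSSetSimplex_δ (σ : Simplex X (n + 1)) (i : Fin (n + 2)) :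
    (TopCat.toSSet.obj (TopCat.of X)).δ i (toSSetSimplex σ) =
      toSSetSimplex (σ.comp (faceMap n i)) := rfl

theorem bd_single (σ : Simplex X (n + 1)) :
    bd X (n + 1) n (single σ) =
      ∑ i : Fin (n + 2), (-1 : ℤ) ^ i.val • single (σ.comp (faceMap n i)) := by
  have h := (TopCat.toSSet.obj (TopCat.of X)).ιChainComplex_d (ModuleCat.of ℤ ℤ) (toSSetSimplex σ)
  have h' := congrArg (fun f => f.hom (1 : ℤ)) h
  simp only [ModuleCat.hom_comp, ModuleCat.hom_sum, toSSetSimplex_δ] at h'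
  refine h'.trans ?_
  simp only [LinearMap.sum_apply]
  refine Finset.sum_congr rfl fun i _ => ?_
  rw [ModuleCat.hom_zsmul]
  rfl

/-- The map on chains induced by a continuous map. -/
abbrev map (f : C(X, Y)) (n : ℕ) : Chain X n →ₗ[ℤ] Chain Y n :=
  ((SSet.chainComplexMap (TopCat.toSSet.map (TopCat.ofHom f)) (ModuleCat.of ℤ ℤ)).f n).hom

theorem map_single (f : C(X, Y)) (σ : Simplex X n) : map f n (single σ) = single (f.comp σ) := by
  have h := SSet.ι_chainComplexMap_f _ _ (TopCat.toSSet.map (TopCat.ofHom f)) (ModuleCat.of ℤ ℤ)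
    (toSSetSimplex σ)
  exact congrArg (fun f => f.hom (1 : ℤ)) h

/-- The chain group is a coproduct of copies of ℤ indexed by the simplices, so values on simplices
can be prescribed freely. -/
theorem exists_linearMap {M : Type} [AddCommGroup M] [Module ℤ M] (φ : Simplex X n → M) :
    ∃ Φ : Chain X n →ₗ[ℤ] M, ∀ σ, Φ (single σ) = φ σ := by
  let hc := (TopCat.toSSet.obj (TopCat.of X)).isColimitChainComplexXCofan (ModuleCat.of ℤ ℤ) n
  let f := Limits.Cofan.IsColimit.desc hc (A := ModuleCat.of ℤ M) fun s =>
    ModuleCat.ofHom (LinearMap.toSpanSingleton ℤ M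
      (φ ((TopCat.of X).toSSetObjEquiv (.op ⦋n⦌) s)))
  refine ⟨f.hom, fun σ => ?_⟩
  have h := Limits.Cofan.IsColimit.fac hc (A := ModuleCat.of ℤ M) (fun s =>
    ModuleCat.ofHom (LinearMap.toSpanSingleton ℤ M
      (φ ((TopCat.of X).toSSetObjEquiv (.op ⦋n⦌) s)))) (toSSetSimplex σ)
  have h' := congrArg (fun f => f.hom (1 : ℤ)) h
  refine h'.trans ?_
  simp only [toSSetSimplex, Equiv.apply_symm_apply]
  exact LinearMap.toSpanSingleton_apply_one ℤ _ _

theorem linearMap_ext {M : Type} [AddCommGroup M] [Module ℤ M] {f g : Chain X n →ₗ[ℤ] M}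
    (h : ∀ σ, f (single σ) = g (single σ)) : f = g := by
  have : ModuleCat.ofHom (Y := ModuleCat.of ℤ M) f = ModuleCat.ofHom (Y := ModuleCat.of ℤ M) g := by
    refine SSet.chainComplex_hom_ext fun s => ?_
    ext
    simpa [single, toSSetSimplex] using h ((TopCat.of X).toSSetObjEquiv (.op ⦋n⦌) s)
  exact congrArg ModuleCat.Hom.hom this

/-- Composing with `L.mkQ` turns membership into vanishing, which `linearMap_ext` tests on
simplices; no chain has to be expanded as a sum. -/
theorem apply_mem_of_single {M : Type} [AddCommGroup M] [Module ℤ M] (L : Submodule ℤ M)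
    (f : Chain X n →ₗ[ℤ] M) (h : ∀ σ, f (single σ) ∈ L) (c : Chain X n) : f c ∈ L := by
  have h0 : L.mkQ ∘ₗ f = 0 :=
    @linearMap_ext X _ n (M ⧸ L) _ (Submodule.Quotient.module L) _ _ fun σ =>
      (Submodule.Quotient.mk_eq_zero L).2 (h σ)
  exact (Submodule.Quotient.mk_eq_zero L).1
    (congrArg (fun f : @LinearMap ℤ ℤ _ _ _ _ (M ⧸ L) _ _ _ (Submodule.Quotient.module L) => f c) h0)

/-- One-chains modulo boundaries. -/
abbrev ChainClass (X : Type) [TopologicalSpace X] : ModuleCat.{0} ℤ := (complex X).opcycles 1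

/-- The class of a one-chain modulo boundaries. -/
def classOf (X : Type) [TopologicalSpace X] : Chain X 1 →ₗ[ℤ] ChainClass X :=
  ((complex X).pOpcycles 1).hom

/-- The inclusion of the first homology group into the one-chains modulo boundaries. -/
def ofH₁ (X : Type) [TopologicalSpace X] : SchottkyShift.H₁ X →ₗ[ℤ] ChainClass X :=
  ((complex X).homologyι 1).hom

/-- Identities in homology can thus be verified in `ChainClass`, where paths that are not closed
also have a class. -/
theorem ofH₁_injective : Function.Injective (ofH₁ X) :=
  (ModuleCat.mono_iff_injective ((complex X).homologyι 1)).1 inferInstance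

theorem exists_cycle_of_H₁ (h : SchottkyShift.H₁ X) :
    ∃ c : Chain X 1, bd X 1 0 c = 0 ∧ ofH₁ X h = classOf X c := by
  obtain ⟨z, rfl⟩ := (ModuleCat.epi_iff_surjective ((complex X).homologyπ 1)).1 inferInstance h
  exact ⟨((complex X).iCycles 1).hom z, congrArg (fun f => f.hom z) ((complex X).iCycles_d 1 0),
    congrArg (fun f => f.hom z) ((complex X).homology_π_ι 1)⟩

theorem exists_H₁_of_cycle (c : Chain X 1) (hc : bd X 1 0 c = 0) :
    ∃ h : SchottkyShift.H₁ X, ofH₁ X h = classOf X c := by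
  let f : ModuleCat.of ℤ ℤ ⟶ (complex X).X 1 :=
    ModuleCat.ofHom (LinearMap.toSpanSingleton ℤ (Chain X 1) c)
  have hf1 : f.hom (1 : ℤ) = c := LinearMap.toSpanSingleton_apply_one ℤ _ _
  have hf : f ≫ (complex X).d 1 0 = 0 := by
    ext
    exact (congrArg (bd X 1 0) hf1).trans hc
  refine ⟨((complex X).homologyπ 1).hom (((complex X).liftCycles f 0 (by simp) hf).hom (1 : ℤ)), ?_⟩
  have h1 : (complex X).liftCycles f 0 (by simp) hf ≫ (complex X).homologyπ 1 ≫
      (complex X).homologyι 1 = f ≫ (complex X).pOpcycles 1 := by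
    rw [(complex X).homology_π_ι 1, ← Category.assoc, (complex X).liftCycles_i]
  refine (congrArg (fun f => f.hom (1 : ℤ)) h1).trans ?_
  exact congrArg (classOf X) hf1

/-- The map on chains modulo boundaries induced by a continuous map. -/
def mapClass (f : C(X, Y)) : ChainClass X →ₗ[ℤ] ChainClass Y :=
  (HomologicalComplex.opcyclesMap
    (SSet.chainComplexMap (TopCat.toSSet.map (TopCat.ofHom f)) (ModuleCat.of ℤ ℤ)) 1).hom

theorem mapClass_classOf (f : C(X, Y)) (c : Chain X 1) :
    mapClass f (classOf X c) = classOf Y (map f 1 c) :=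
  congrArg (fun f => f.hom c) (HomologicalComplex.p_opcyclesMap
    (SSet.chainComplexMap (TopCat.toSSet.map (TopCat.ofHom f)) (ModuleCat.of ℤ ℤ)) 1)

theorem ofH₁_map (f : C(X, Y)) (h : SchottkyShift.H₁ X) :
    ofH₁ Y (SchottkyShift.H₁.map f h) = mapClass f (ofH₁ X h) :=
  congrArg (fun f => f.hom h) (HomologicalComplex.homologyι_naturality
    (SSet.chainComplexMap (TopCat.toSSet.map (TopCat.ofHom f)) (ModuleCat.of ℤ ℤ)) 1)

/-- A linear map on one-chains vanishing on boundaries factors through the chain classes. -/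
theorem exists_factor {M : Type} [AddCommGroup M] [Module ℤ M] (Φ : Chain X 1 →ₗ[ℤ] M)
    (h : ∀ τ : Simplex X 2, Φ (bd X 2 1 (single τ)) = 0) :
    ∃ Ψ : ChainClass X →ₗ[ℤ] M, ∀ c, Ψ (classOf X c) = Φ c := by
  have h0 : Φ ∘ₗ bd X 2 1 = 0 := linearMap_ext h
  let f : (complex X).X 1 ⟶ ModuleCat.of ℤ M := ModuleCat.ofHom Φ
  have hf : (complex X).d 2 1 ≫ f = 0 := by
    ext c
    exact congrArg (fun f => f c) h0
  refine ⟨((complex X).descOpcycles f 2 (by simp) hf).hom, fun c => ?_⟩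
  exact congrArg (fun f => f.hom c) ((complex X).p_descOpcycles f 2 (by simp) hf)

/-- The identity is homotopic to a constant map, which factors through a point; the point is totally
disconnected, so its first homology vanishes. -/
theorem H₁_eq_zero_of_contractible [ContractibleSpace X] (h : SchottkyShift.H₁ X) : h = 0 := by
  obtain ⟨p, ⟨H⟩⟩ := id_nullhomotopic X
  have h1 := TopCat.Homotopy.congr_homologyMap_singularChainComplexFunctor
    (X := TopCat.of X) (Y := TopCat.of X) (f := TopCat.ofHom (ContinuousMap.id X))
    (g := TopCat.ofHom (ContinuousMap.const X p)) H (ModuleCat.of ℤ ℤ) 1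
  have h2 : SchottkyShift.H₁.map (ContinuousMap.id X) =
    SchottkyShift.H₁.map (ContinuousMap.const X p) := congrArg ModuleCat.Hom.hom h1
  have h3 : SchottkyShift.H₁.map (ContinuousMap.id X) h = h := by
    have := (((singularHomologyFunctor (ModuleCat.{0} ℤ) 1).obj
      (ModuleCat.of ℤ ℤ)).map_id (TopCat.of X))
    exact congrArg (fun f => f.hom h) this
  have h4 : SchottkyShift.H₁.map (ContinuousMap.const X p) h =
      SchottkyShift.H₁.map (ContinuousMap.const Unit p)
        (SchottkyShift.H₁.map (ContinuousMap.const X ()) h) := by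
    have := (((singularHomologyFunctor (ModuleCat.{0} ℤ) 1).obj
      (ModuleCat.of ℤ ℤ)).map_comp (TopCat.ofHom (ContinuousMap.const X ()))
        (TopCat.ofHom (ContinuousMap.const Unit p)))
    exact congrArg (fun f => f.hom h) this
  have h5 := isZero_singularHomologyFunctor_of_totallyDisconnectedSpace (ModuleCat.{0} ℤ) 1
    (ModuleCat.of ℤ ℤ) (TopCat.of Unit) one_ne_zero
  have h6 : SchottkyShift.H₁.map (ContinuousMap.const X ()) h = 0 :=
    @Subsingleton.elim _ (ModuleCat.subsingleton_of_isZero h5) _ _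
  rw [← h3, h2, h4, h6, map_zero]

theorem classOf_eq_zero_of_contractible [ContractibleSpace X] (c : Chain X 1)
    (hc : bd X 1 0 c = 0) : classOf X c = 0 := by
  obtain ⟨h, hh⟩ := exists_H₁_of_cycle c hc
  rw [← hh, H₁_eq_zero_of_contractible h, map_zero]

end SingularChains
end

noncomputable section

open CategoryTheory AlgebraicTopology Simplicial

/-! ### Segments of curves -/

namespace SingularChains
variable {X : Type} [TopologicalSpace X]

theorem simplex_zero_ext {σ τ : Simplex X 0} (h : σ default = τ default) : σ = τ := by
  ext x
  rw [Subsingleton.elim x default, h]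

/-- The zero-simplex at a point. -/
def point (p : X) : Simplex X 0 := .const _ p

theorem faceMap_vertex {n : ℕ} (i : Fin (n + 2)) (j : Fin (n + 1)) :
    faceMap n i (stdSimplex.vertex j) = stdSimplex.vertex (i.succAbove j) :=
  stdSimplex.map_vertex _ _

theorem default_eq_vertex : (default : stdSimplex ℝ (Fin 1)) = stdSimplex.vertex 0 :=
  Subsingleton.elim _ _

theorem bd_single_one (σ : Simplex X 1) :
    bd X 1 0 (single σ) =
      single (point (σ (stdSimplex.vertex 1))) - single (point (σ (stdSimplex.vertex 0))) := by
  have h0 : σ.comp (faceMap 0 0) = point (σ (stdSimplex.vertex 1)) :=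
    simplex_zero_ext (congrArg σ (by rw [default_eq_vertex, faceMap_vertex]; rfl))
  have h1 : σ.comp (faceMap 0 1) = point (σ (stdSimplex.vertex 0)) :=
    simplex_zero_ext (congrArg σ (by rw [default_eq_vertex, faceMap_vertex]; rfl))
  rw [bd_single, Fin.sum_univ_two, h0, h1]
  simp [sub_eq_add_neg]

theorem bd_single_two (σ : Simplex X 2) :
    bd X 2 1 (single σ) = single (σ.comp (faceMap 1 0)) - single (σ.comp (faceMap 1 1)) +
      single (σ.comp (faceMap 1 2)) := by
  rw [bd_single, Fin.sum_univ_three]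
  simp [sub_eq_add_neg]

/-- The affine path in the line. -/
def affinePath (s t : ℝ) : Simplex ℝ 1 where
  toFun x := s * x 0 + t * x 1
  continuous_toFun := by
    have h : ∀ i, Continuous fun x : stdSimplex ℝ (Fin 2) => x i := fun i =>
      (continuous_apply i).comp continuous_subtype_val
    exact (continuous_const.mul (h 0)).add (continuous_const.mul (h 1))

@[simp] theorem affinePath_vertex_zero (s t : ℝ) :
    affinePath s t (stdSimplex.vertex 0) = s := by
  change s * (Pi.single (0 : Fin 2) (1 : ℝ) : Fin 2 → ℝ) 0 +
    t * (Pi.single (0 : Fin 2) (1 : ℝ) : Fin 2 → ℝ) 1 = s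
  simp

@[simp] theorem affinePath_vertex_one (s t : ℝ) :
    affinePath s t (stdSimplex.vertex 1) = t := by
  change s * (Pi.single (1 : Fin 2) (1 : ℝ) : Fin 2 → ℝ) 0 +
    t * (Pi.single (1 : Fin 2) (1 : ℝ) : Fin 2 → ℝ) 1 = t
  simp

theorem affinePath_add (s t u : ℝ) (x : stdSimplex ℝ (Fin 2)) :
    affinePath (s + u) (t + u) x = affinePath s t x + u := by
  have h : x 0 + x 1 = 1 := stdSimplex.add_eq_one x
  change (s + u) * x 0 + (t + u) * x 1 = s * x 0 + t * x 1 + u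
  linear_combination u * h

/-- The class of a segment of a curve. -/
def segment (γ : C(ℝ, X)) (s t : ℝ) : ChainClass X :=
  classOf X (single (γ.comp (affinePath s t)))

theorem classOf_map_eq_zero (γ : C(ℝ, X)) {c : Chain ℝ 1} (hc : bd ℝ 1 0 c = 0) :
    classOf X (map γ 1 c) = 0 := by
  rw [← mapClass_classOf, classOf_eq_zero_of_contractible c hc, map_zero]

/-- Two paths in ℝ with the same endpoints differ by a cycle, and one-cycles in ℝ bound. -/
theorem classOf_comp (γ : C(ℝ, X)) (f : Simplex ℝ 1) :
    classOf X (single (γ.comp f)) =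
      segment γ (f (stdSimplex.vertex 0)) (f (stdSimplex.vertex 1)) := by
  rw [segment, ← sub_eq_zero, ← map_sub, ← map_single, ← map_single, ← map_sub]
  refine classOf_map_eq_zero γ ?_
  rw [map_sub, bd_single_one, bd_single_one]
  simp

theorem segment_add (γ : C(ℝ, X)) (s t u : ℝ) :
    segment γ s t + segment γ t u = segment γ s u := by
  simp only [segment]
  rw [← sub_eq_zero, ← map_add, ← map_sub, ← map_single, ← map_single, ← map_single, ← map_add,
    ← map_sub]
  refine classOf_map_eq_zero γ ?_
  rw [map_sub, map_add, bd_single_one, bd_single_one, bd_single_one]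
  simp

theorem segment_self (γ : C(ℝ, X)) (s : ℝ) : segment γ s s = 0 := by
  have := segment_add γ s s s
  simpa using this

/-! ### Homology of line systems -/

/-- A space all of whose singular simplices lie on a family of lines permuted by `T`, with
`ℓ (T a) (t + 1) = ℓ a t` as the only identifications. -/
structure IsLineSystem {A : Type} (T : Equiv.Perm A) (ℓ : A → C(ℝ, X)) : Prop where
  exists_lift : ∀ (n : ℕ) (σ : Simplex X n), ∃ a, ∃ f : Simplex ℝ n, σ = (ℓ a).comp f
  eq_iff : ∀ {a b s t}, ℓ a s = ℓ b t ↔ ∃ n : ℤ, b = (T ^ n) a ∧ t = s + n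

/-- The set of orbits of a permutation. -/
abbrev Orbits {A : Type} (T : Equiv.Perm A) : Type := Quotient (Equiv.Perm.SameCycle.setoid T)

/-- The class of the orbit through `a`, run through once. -/
def loopClass {A : Type} (T : Equiv.Perm A) (ℓ : A → C(ℝ, X)) (a : A) : ChainClass X :=
  segment (ℓ a) 0 (Function.minimalPeriod T a)

theorem minimalPeriod_zpow_apply {A : Type} (T : Equiv.Perm A) (n : ℤ) (a : A) :
    Function.minimalPeriod T ((T ^ n) a) = Function.minimalPeriod T a := by
  have key : ∀ k, Function.minimalPeriod T ((T ^ n) a) ∣ k ↔ Function.minimalPeriod T a ∣ k := by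
    intro k
    rw [← Function.isPeriodicPt_iff_minimalPeriod_dvd, ← Function.isPeriodicPt_iff_minimalPeriod_dvd,
      Function.IsPeriodicPt, Function.IsPeriodicPt, Function.IsFixedPt, Function.IsFixedPt,
      ← Equiv.Perm.coe_pow, ← Equiv.Perm.mul_apply, ← zpow_natCast, (Commute.refl T).zpow_zpow k n,
      Equiv.Perm.mul_apply, EmbeddingLike.apply_eq_iff_eq]
  exact Nat.dvd_antisymm ((key _).2 dvd_rfl) ((key _).1 dvd_rfl)

namespace IsLineSystem
variable {A : Type} {T : Equiv.Perm A} {ℓ : A → C(ℝ, X)} (h : IsLineSystem T ℓ)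
include h

theorem zpow_apply (a : A) (n : ℤ) (t : ℝ) : ℓ ((T ^ n) a) (t + n) = ℓ a t :=
  (h.eq_iff.2 ⟨n, rfl, rfl⟩).symm

theorem segment_zpow (a : A) (n : ℤ) (s t : ℝ) :
    segment (ℓ ((T ^ n) a)) (s + n) (t + n) = segment (ℓ a) s t := by
  have : (ℓ ((T ^ n) a)).comp (affinePath (s + n) (t + n)) = (ℓ a).comp (affinePath s t) := by
    ext x
    simp only [ContinuousMap.comp_apply, affinePath_add, h.zpow_apply]
  rw [segment, this, segment]

/-- The segments from `k * N` to `(k + 1) * N` are all translates of the first one, because the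
powers of `T ^ N` fix `a`. -/
theorem segment_mul (a : A) (N : ℤ) (hN : (T ^ N) a = a) (k : ℤ) :
    segment (ℓ a) 0 (k * N) = k • segment (ℓ a) 0 N := by
  have key : ∀ k : ℤ, segment (ℓ a) (k * N) ((k + 1) * N) = segment (ℓ a) 0 N := by
    intro k
    have hk : (T ^ (k * N)) a = a := by
      rw [mul_comm, zpow_mul]
      exact Equiv.Perm.zpow_apply_eq_self_of_apply_eq_self hN k
    have := h.segment_zpow a (k * N) 0 N
    rw [hk] at this
    rw [← this]
    congr 1 <;> push_cast <;> ring
  induction k using Int.induction_on with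
  | zero => simp [segment_self]
  | succ k ih =>
    have h1 := key k
    have h2 := segment_add (ℓ a) 0 ((k : ℤ) * N) (((k : ℤ) + 1) * N)
    push_cast at *
    rw [← h2, ih, h1, add_zsmul, one_zsmul]
  | pred k ih =>
    have h1 := key (-k - 1)
    have h2 := segment_add (ℓ a) 0 ((-(k : ℤ) - 1 : ℤ) * N) ((-(k : ℤ) - 1 + 1 : ℤ) * N)
    push_cast at *
    rw [h1, sub_add_cancel, ih] at h2
    rw [sub_zsmul, one_zsmul, ← h2, ← sub_eq_add_neg, add_sub_cancel_right]

/-- A closed orbit may be started anywhere: moving the start by `-n` adds the piece from `-n` to `0`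
and, by periodicity, the same piece reversed at the far end. For aperiodic `a` the minimal period is
`0` and the argument still applies. -/
theorem loopClass_zpow (n : ℤ) (a : A) : loopClass T ℓ ((T ^ n) a) = loopClass T ℓ a := by
  rw [loopClass, loopClass, minimalPeriod_zpow_apply]
  set N := Function.minimalPeriod T a
  have hN : (T ^ (N : ℤ)) a = a :=
    (MulAction.zpow_smul_eq_iff_minimalPeriod_dvd (a := T) (b := a)).2 dvd_rfl
  have h1 := h.segment_zpow a n (-n) (N - n)
  rw [neg_add_cancel, sub_add_cancel] at h1
  have h2 := h.segment_zpow a N 0 (-n)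
  rw [hN, zero_add, Int.cast_natCast, neg_add_eq_sub] at h2
  have h3 := segment_add (ℓ a) (-n) 0 N
  have h4 := segment_add (ℓ a) (-n) N (N - n)
  have h5 := segment_add (ℓ a) (-n) 0 (-n)
  rw [segment_self] at h5
  rw [h1, ← h4, h2, ← h3, add_right_comm, h5, zero_add]

theorem loopClass_eq_of_sameCycle {a b : A} (hab : T.SameCycle a b) :
    loopClass T ℓ a = loopClass T ℓ b := by
  obtain ⟨n, rfl⟩ := hab
  exact (h.loopClass_zpow n a).symm

theorem segment_mem_span (a : A) (n : ℤ) (hn : (T ^ n) a = a) :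
    segment (ℓ a) 0 n ∈ Submodule.span ℤ (Set.range (loopClass T ℓ)) := by
  obtain ⟨k, rfl⟩ := (MulAction.zpow_smul_eq_iff_minimalPeriod_dvd (a := T) (b := a)).1 hn
  have h1 : (T ^ ((Function.minimalPeriod T a : ℕ) : ℤ)) a = a :=
    (MulAction.zpow_smul_eq_iff_minimalPeriod_dvd (a := T) (b := a)).2 dvd_rfl
  have h2 := h.segment_mul a _ h1 k
  have h3 : segment (ℓ a) 0 (((Function.minimalPeriod T a : ℕ) : ℤ) : ℝ) = loopClass T ℓ a := by
    rw [loopClass]; norm_cast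
  rw [h3] at h2
  have h4 : segment (ℓ a) 0 (((Function.minimalPeriod T a : ℕ) : ℤ) * k : ℤ) = k • loopClass T ℓ a := by
    rw [← h2]; congr 1; push_cast; ring
  refine Eq.subst (motive := (· ∈ _)) h4.symm ?_
  exact zsmul_mem (Submodule.subset_span (Set.mem_range_self a)) k

/-- A map `P` on zero-chains sends a point to the segment joining it to the origin of its orbit.
Modulo closed orbits, every one-chain agrees with `P` of its boundary, so a cycle lies in the span.
-/
theorem classOf_mem_span (c : Chain X 1) (hc : bd X 1 0 c = 0) :
    classOf X c ∈ Submodule.span ℤ (Set.range (loopClass T ℓ)) := by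
  set L := Submodule.span ℤ (Set.range (loopClass T ℓ)) with hL
  -- One line per orbit, so that all points of an orbit are measured from a common origin.
  let base : A → A := fun a => (Quotient.mk (Equiv.Perm.SameCycle.setoid T) a).out
  have hbase : ∀ a, ∃ n : ℤ, (T ^ n) (base a) = a := fun a =>
    Quotient.mk_out (s := Equiv.Perm.SameCycle.setoid T) a
  have hbase_eq : ∀ a b : A, T.SameCycle (base a) (base b) → base a = base b := by
    intro a b hab
    have h1 : (Quotient.mk (Equiv.Perm.SameCycle.setoid T) a) =
        Quotient.mk (Equiv.Perm.SameCycle.setoid T) b :=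
      Quotient.sound (((Equiv.Perm.SameCycle.symm (hbase a)).trans hab).trans (hbase b))
    exact congrArg Quotient.out h1
  have hpt : ∀ p : X, ∃ a t, p = ℓ (base a) t := by
    intro p
    obtain ⟨a, f, hf⟩ := h.exists_lift 0 (point p)
    obtain ⟨n, hn⟩ := hbase a
    refine ⟨a, f default - n, ?_⟩
    have h1 : p = ℓ a (f default) := congrArg (fun σ : Simplex X 0 => σ default) hf
    have h2 := h.zpow_apply (base a) n (f default - n)
    rw [hn, sub_add_cancel] at h2
    rw [h1, h2]
  choose a t hat using hpt
  obtain ⟨P, hP⟩ := exists_linearMap (X := X) (n := 0) (M := ChainClass X)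
    fun σ => segment (ℓ (base (a (σ default)))) 0 (t (σ default))
  -- The chosen time of a point is unique only up to an integer `n` with `T ^ n` fixing the base
  -- line; the ambiguity is a closed segment, which lies in `L`.
  have hPt : ∀ b s, P (single (point (ℓ (base b) s))) - segment (ℓ (base b)) 0 s ∈ L := by
    intro b s
    rw [hP]
    set p := ℓ (base b) s
    obtain ⟨n, hn1, hn2⟩ := h.eq_iff.1 (hat p)
    have hb : base b = base (a p) := hbase_eq _ _ ⟨n, hn1.symm⟩
    rw [hb] at hn1 ⊢
    change segment (ℓ (base (a p))) 0 (t p) - _ ∈ L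
    have h1 := segment_add (ℓ (base (a p))) 0 n (t p)
    have h2 := h.segment_zpow (base (a p)) n 0 s
    rw [← hn1, zero_add, ← hn2] at h2
    rw [← h1, h2, add_sub_cancel_right]
    exact h.segment_mem_span _ n hn1.symm
  have key : ∀ c, classOf X c - P (bd X 1 0 c) ∈ L := by
    intro c
    refine apply_mem_of_single L (classOf X - P ∘ₗ bd X 1 0) (fun σ => ?_) c
    · rw [LinearMap.sub_apply, LinearMap.comp_apply, bd_single_one, map_sub]
      obtain ⟨a, f, rfl⟩ := h.exists_lift 1 σ
      obtain ⟨n, hn⟩ := hbase a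
      have hℓ : ∀ x, ℓ a x = ℓ (base a) (x - n) := by
        intro x
        have h2 := h.zpow_apply (base a) n (x - n)
        rwa [hn, sub_add_cancel] at h2
      have h1 := hPt a (f (stdSimplex.vertex 0) - n)
      have h2 := hPt a (f (stdSimplex.vertex 1) - n)
      have h3 := segment_add (ℓ (base a)) 0 (f (stdSimplex.vertex 0) - n)
        (f (stdSimplex.vertex 1) - n)
      have h4 := h.segment_zpow (base a) n (f (stdSimplex.vertex 0) - n)
        (f (stdSimplex.vertex 1) - n)
      rw [hn, sub_add_cancel, sub_add_cancel] at h4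
      rw [classOf_comp, h4, ContinuousMap.comp_apply, ContinuousMap.comp_apply, hℓ, hℓ]
      have h5 := L.sub_mem h1 h2
      rw [← h3] at h5
      convert h5 using 1
      abel
  simpa [hc] using key c

/-- Two lifts of one simplex differ by a continuous integer-valued function on a connected space,
hence by a constant. -/
theorem eq_of_comp_eq {n : ℕ} {a b : A} {f g : Simplex ℝ n} (hfg : (ℓ a).comp f = (ℓ b).comp g) :
    T.SameCycle a b ∧ ∀ x y, g x - g y = f x - f y := by
  have h1 : ∀ x, ∃ k : ℤ, b = (T ^ k) a ∧ g x = f x + k := fun x =>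
    h.eq_iff.1 (congrArg (fun σ : Simplex X n => σ x) hfg)
  refine ⟨⟨(h1 (stdSimplex.vertex 0)).choose, (h1 (stdSimplex.vertex 0)).choose_spec.1.symm⟩,
    fun x y => ?_⟩
  have h2 : _root_.IsDiscrete (Set.range ((↑) : ℤ → ℝ)) := by
    rw [isDiscrete_iff_discreteTopology]
    exact Int.isClosedEmbedding_coe_real.isEmbedding.toHomeomorph.discreteTopology_iff.1
      inferInstance
  have h3 : g x - f x = g y - f y :=
    isPreconnected_univ.constant_of_mapsTo h2 (f := fun x => g x - f x)
      (g.continuous.sub f.continuous).continuousOn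
      (fun x _ => ⟨(h1 x).choose, by linarith [(h1 x).choose_spec.2]⟩)
      (Set.mem_univ x) (Set.mem_univ y)
  linarith

-- The cocycle is signed length, recorded at the orbit. It does not depend on the lift by
-- `eq_of_comp_eq`, and it kills boundaries because the three differences around a triangle cancel.
open scoped Classical in
theorem exists_dual : ∃ Ψ : ChainClass X →ₗ[ℤ] (Orbits T → ℝ), ∀ a s t,
    Ψ (segment (ℓ a) s t) = Pi.single (Quotient.mk _ a) (t - s) := by
  choose a f hf using h.exists_lift 1
  obtain ⟨Φ, hΦ⟩ := exists_linearMap (X := X) (n := 1) (M := Orbits T → ℝ) fun σ =>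
    Pi.single (Quotient.mk _ (a σ)) (f σ (stdSimplex.vertex 1) - f σ (stdSimplex.vertex 0))
  have hΦ' : ∀ b (g : Simplex ℝ 1), Φ (single ((ℓ b).comp g)) =
      Pi.single (Quotient.mk _ b) (g (stdSimplex.vertex 1) - g (stdSimplex.vertex 0)) := by
    intro b g
    obtain ⟨h1, h2⟩ := h.eq_of_comp_eq (hf ((ℓ b).comp g))
    rw [hΦ, ← h2, Quotient.sound (s := Equiv.Perm.SameCycle.setoid T) h1]
  obtain ⟨Ψ, hΨ⟩ := exists_factor Φ fun τ => by
    obtain ⟨b, g, rfl⟩ := h.exists_lift 2 τ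
    rw [bd_single_two, map_add, map_sub]
    simp only [ContinuousMap.comp_assoc, hΦ', ContinuousMap.comp_apply, faceMap_vertex]
    rw [← Pi.single_sub, ← Pi.single_add, Pi.single_eq_zero_iff]
    change g (stdSimplex.vertex 2) - g (stdSimplex.vertex 1) -
      (g (stdSimplex.vertex 2) - g (stdSimplex.vertex 0)) +
      (g (stdSimplex.vertex 1) - g (stdSimplex.vertex 0)) = 0
    ring
  refine ⟨Ψ, fun b s t => ?_⟩
  rw [segment, hΨ, hΦ', affinePath_vertex_zero, affinePath_vertex_one]

end IsLineSystem
end SingularChains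
end

/-! ### Covering maps: the circle and the mapping torus as line systems -/

noncomputable section

open CategoryTheory AlgebraicTopology Simplicial


/-- Composed with a contraction of `A` run backwards, `f` becomes the end of a homotopy starting at
a constant map. The constant lifts, and homotopy lifting carries the lift to time `1`. -/
theorem IsCoveringMap.exists_lift_of_contractible {E X A : Type*} [TopologicalSpace E]
    [TopologicalSpace X] [TopologicalSpace A] [ContractibleSpace A] {p : E → X}
    (cov : IsCoveringMap p) (hp : Function.Surjective p) (f : C(A, X)) :
    ∃ F : C(A, E), ∀ a, p (F a) = f a := by
  obtain ⟨a₀, ⟨H⟩⟩ := id_nullhomotopic A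
  obtain ⟨e₀, he₀⟩ := hp (f a₀)
  have h0 : ∀ a, (f.comp H.symm.toContinuousMap) (0, a) = p (ContinuousMap.const A e₀ a) := by
    intro a
    change f (H.symm (0, a)) = p e₀
    rw [H.symm.apply_zero, he₀]
    rfl
  refine ⟨(cov.liftHomotopy (f.comp H.symm.toContinuousMap) (.const A e₀) h0).comp
    ((ContinuousMap.const A 1).prodMk (.id A)), fun a => ?_⟩
  have h1 := congrFun (cov.liftHomotopy_lifts (f.comp H.symm.toContinuousMap) (.const A e₀) h0)
    (1, a)
  refine h1.trans ?_
  change f (H.symm (1, a)) = f a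
  rw [H.symm.apply_one]
  rfl

instance (n : ℕ) : ContractibleSpace (stdSimplex ℝ (Fin (n + 1))) :=
  (convex_stdSimplex ℝ (Fin (n + 1))).contractibleSpace ⟨_, (stdSimplex.vertex 0).2⟩

namespace SingularChains

theorem isLineSystem_circle :
    IsLineSystem (1 : Equiv.Perm Unit)
      fun _ => (⟨fun t : ℝ => (t : UnitAddCircle), AddCircle.continuous_mk' 1⟩ :
        C(ℝ, UnitAddCircle)) where
  exists_lift n σ := by
    obtain ⟨F, hF⟩ := (AddCircle.isCoveringMap_coe (1 : ℝ)).exists_lift_of_contractible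
      (QuotientAddGroup.mk_surjective) σ
    exact ⟨(), F, ContinuousMap.ext fun a => (hF a).symm⟩
  eq_iff {a b s t} := by
    change (s : UnitAddCircle) = t ↔ _
    rw [eq_comm, ← sub_eq_zero, ← AddCircle.coe_sub, AddCircle.coe_eq_zero_iff]
    simp only [zsmul_eq_mul, mul_one, one_zpow, Equiv.Perm.one_apply, true_and]
    exact exists_congr fun n => ⟨fun h => by linarith, fun h => by linarith⟩

end SingularChains

namespace SchottkyShift
variable {g : ℕ}

/-- The translation action of `ℤ` on `𝒮 × ℝ` with quotient the mapping torus. -/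
abbrev lineAction (g : ℕ) : AddAction ℤ (Seq g × ℝ) where
  vadd n p := (shiftPow n p.1, p.2 + n)
  zero_vadd p := by
    refine Prod.ext (Subtype.ext (funext fun k => ?_)) ?_
    · change p.1.1 (k + 0) = p.1.1 k
      rw [add_zero]
    · change p.2 + ((0 : ℤ) : ℝ) = p.2
      simp
  add_vadd m n p := by
    refine Prod.ext (Subtype.ext (funext fun k => ?_)) ?_
    · change p.1.1 (k + (m + n)) = p.1.1 (k + m + n)
      rw [add_assoc]
    · change p.2 + ((m + n : ℤ) : ℝ) = p.2 + n + m
      push_cast; ring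

theorem line_shiftPow (n : ℤ) (x : Seq g) (t : ℝ) : line (shiftPow n x) (t + n) = line x t := by
  have h1 : shiftPow (-⌊t + n⌋) (shiftPow n x) = shiftPow (-⌊t⌋) x := by
    ext1; funext k
    change x.1 (k + -⌊t + n⌋ + n) = x.1 (k + -⌊t⌋)
    exact congrArg x.1 (by rw [Int.floor_add_intCast]; ring)
  unfold line
  rw [h1]
  congr 2
  exact Int.fract_add_intCast t n

theorem line_eq_line_iff {x y : Seq g} {s t : ℝ} :
    line x s = line y t ↔ ∃ n : ℤ, y = shiftPow n x ∧ t = s + n := by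
  let := lineAction g
  constructor
  · intro h
    let f : MappingTorus g → Quotient (AddAction.orbitRel ℤ (Seq g × ℝ)) :=
      Quot.lift (fun p => Quotient.mk _ (p.1, (p.2 : ℝ))) (by
        rintro ⟨p, u⟩ ⟨q, v⟩ ⟨h1, h2, h3⟩
        dsimp only at h1 h2 h3
        subst h1 h2 h3
        -- Translation by `-1` takes `(T p, 1)` to `(p, 0)`.
        refine Quotient.sound ⟨-1, ?_⟩
        refine Prod.ext (Subtype.ext (funext fun k => ?_)) ?_
        · change p.1 (k + -1 + 1) = p.1 k
          rw [neg_add_cancel_right]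
        · change ((1 : unitInterval) : ℝ) + ((-1 : ℤ) : ℝ) = ((0 : unitInterval) : ℝ)
          simp)
    have hf : ∀ x s, f (line x s) = Quotient.mk _ (x, s) := by
      intro x s
      refine Quotient.sound ⟨-⌊s⌋, ?_⟩
      refine Prod.ext rfl ?_
      change s + ((-⌊s⌋ : ℤ) : ℝ) = Int.fract s
      rw [Int.fract]; push_cast; ring
    have h1 := congrArg f h
    rw [hf, hf] at h1
    obtain ⟨n, hn⟩ := Quotient.exact h1.symm
    exact ⟨n, (congrArg Prod.fst hn).symm, (congrArg Prod.snd hn).symm⟩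
  · rintro ⟨n, rfl, rfl⟩
    exact (line_shiftPow n x s).symm

theorem continuous_shiftPow (n : ℤ) : Continuous (shiftPow n : Seq g → Seq g) := by
  refine Continuous.subtype_mk (continuous_pi fun k => ?_) _
  exact (continuous_apply (k + n)).comp continuous_subtype_val

theorem continuous_uncurry_line : Continuous fun p : Seq g × ℝ => line p.1 p.2 := by
  have hlf : LocallyFinite fun n : ℤ =>
      (Prod.snd : Seq g × ℝ → ℝ) ⁻¹' Set.Icc (n : ℝ) (n + 1) :=
    LocallyFinite.preimage_continuous (f := fun n : ℤ => Set.Icc (n : ℝ) (n + 1)) (by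
      intro t
      refine ⟨Set.Ioo (t - 1) (t + 1), Ioo_mem_nhds (by linarith) (by linarith), ?_⟩
      refine (Set.finite_Icc (⌊t⌋ - 2) (⌊t⌋ + 2)).subset ?_
      rintro n ⟨s, hs, hs'⟩
      have h1 := Int.floor_le t
      have h2 := Int.lt_floor_add_one t
      simp only [Set.mem_Icc, Set.mem_Ioo] at *
      constructor
      · have : ((⌊t⌋ - 2 : ℤ) : ℝ) < n := by push_cast; linarith
        exact_mod_cast this.le
      · have : (n : ℝ) < ((⌊t⌋ + 2 : ℤ) : ℝ) := by push_cast; linarith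
        exact_mod_cast this.le) continuous_snd
  refine hlf.continuous ?_ (fun n => isClosed_Icc.preimage continuous_snd) ?_
  · refine Set.eq_univ_of_forall fun p => Set.mem_iUnion.2 ⟨⌊p.2⌋, Int.floor_le p.2, ?_⟩
    exact (Int.lt_floor_add_one p.2).le
  · intro n
    rw [continuousOn_iff_continuous_domRestrict]
    have : (Prod.snd ⁻¹' Set.Icc (n : ℝ) (n + 1)).domRestrict (fun p : Seq g × ℝ => line p.1 p.2) =
        fun p => MappingTorus.mk (shiftPow (-n) p.1.1)
          ⟨p.1.2 - n, by linarith [p.2.1], by linarith [p.2.2]⟩ := by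
      funext p; exact line_eq_of_mem p.1.1 n p.1.2 p.2
    rw [this]
    refine (MappingTorus.continuous_mk (g := g)).comp
      (((continuous_shiftPow _).comp (continuous_fst.comp continuous_subtype_val)).prodMk ?_)
    exact Continuous.subtype_mk
      ((continuous_snd.comp continuous_subtype_val).sub continuous_const) _

theorem line_of_unitInterval (x : Seq g) (t : unitInterval) : line x t = MappingTorus.mk x t := by
  have h := line_eq_of_mem x 0 (t : ℝ) ⟨by simpa using t.2.1, by simpa using t.2.2⟩
  rw [h]
  congr 1
  · ext1; funext k
    change x.1 (k + -0) = x.1 k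
    simp
  · exact Subtype.ext (by simp)

/-- The restriction to `Seq g × [0, 1]` is already the defining quotient map. -/
theorem isQuotientMap_line :
    Topology.IsQuotientMap fun p : Seq g × ℝ => line p.1 p.2 := by
  refine Topology.IsQuotientMap.of_comp (f := fun p : Seq g × unitInterval => (p.1, (p.2 : ℝ)))
    (continuous_fst.prodMk (continuous_subtype_val.comp continuous_snd)) continuous_uncurry_line ?_
  have : (fun p : Seq g × ℝ => line p.1 p.2) ∘ (fun p : Seq g × unitInterval => (p.1, (p.2 : ℝ))) =
      Quot.mk (torusRel g) := by
    funext p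
    exact line_of_unitInterval p.1 p.2
  rw [this]
  exact isQuotientMap_quot_mk

theorem isCoveringMap_line : IsCoveringMap fun p : Seq g × ℝ => line p.1 p.2 := by
  let := lineAction g
  suffices h : IsAddQuotientCoveringMap (fun p : Seq g × ℝ => line p.1 p.2) ℤ from h.isCoveringMap
  refine
    { toIsQuotientMap := isQuotientMap_line
      continuous_const_vadd := fun n =>
        ((continuous_shiftPow n).comp continuous_fst).prodMk (continuous_snd.add continuous_const)
      apply_eq_iff_mem_orbit := ?_
      disjoint := ?_ }
  · intro p q
    rw [eq_comm, line_eq_line_iff]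
    exact ⟨fun ⟨n, h1, h2⟩ => ⟨n, Prod.ext h1.symm h2.symm⟩,
      fun ⟨n, hn⟩ => ⟨n, (congrArg Prod.fst hn).symm, (congrArg Prod.snd hn).symm⟩⟩
  · rintro ⟨x, t⟩
    -- An open interval of length `1` misses its nonzero integer translates, so the real coordinate
    -- alone separates the sheets.
    refine ⟨Set.univ ×ˢ Set.Ioo (t - 1 / 2) (t + 1 / 2),
      prod_mem_nhds Filter.univ_mem (Ioo_mem_nhds (by linarith) (by linarith)), ?_⟩
    rintro n ⟨_, ⟨⟨y, s⟩, ⟨-, hs1, hs2⟩, rfl⟩, -, hs3, hs4⟩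
    change t - 1 / 2 < s + n at hs3
    change s + n < t + 1 / 2 at hs4
    dsimp only at hs1 hs2
    have h1 : (n : ℝ) < 1 := by linarith
    have h2 : (-1 : ℝ) < n := by linarith
    have h1' : n < 1 := by exact_mod_cast h1
    have h2' : -1 < n := by exact_mod_cast h2
    omega

/-- The line through a reduced sequence as a continuous map. -/
def lineMap (x : Seq g) : C(ℝ, MappingTorus g) := ⟨line x, continuous_line x⟩

theorem isLineSystem_mappingTorus (g : ℕ) :
    SingularChains.IsLineSystem (shift g).toEquiv (lineMap (g := g)) where
  exists_lift n σ := by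
    obtain ⟨F, hF⟩ := (isCoveringMap_line (g := g)).exists_lift_of_contractible
      isQuotientMap_line.surjective σ
    refine ⟨(F (stdSimplex.vertex 0)).1, ⟨fun a => (F a).2, continuous_snd.comp F.continuous⟩,
      ContinuousMap.ext fun a => ?_⟩
    -- Total disconnectedness of `Seq g` enters here: a connected image in it is a single point.
    have h : (F a).1 = (F (stdSimplex.vertex 0)).1 :=
      (isPreconnected_range (continuous_fst.comp F.continuous)).subsingleton
        (Set.mem_range_self a) (Set.mem_range_self (stdSimplex.vertex 0))
    change σ a = line (F (stdSimplex.vertex 0)).1 (F a).2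
    rw [← h, hF]
  eq_iff {x y s t} := by
    simp only [← shiftPow_eq]
    exact line_eq_line_iff

end SchottkyShift
end

/-! ### The fundamental class of the circle and the basis of closed orbits -/

noncomputable section

open CategoryTheory AlgebraicTopology Simplicial

namespace SingularChains
variable {X Y : Type} [TopologicalSpace X] [TopologicalSpace Y]

theorem mapClass_segment (f : C(X, Y)) (γ : C(ℝ, X)) (s t : ℝ) :
    mapClass f (segment γ s t) = segment (f.comp γ) s t := by
  rw [segment, mapClass_classOf, map_single]
  rfl

/-- The universal covering of the circle. -/
def circleLine : C(ℝ, UnitAddCircle) := ⟨fun t : ℝ => (t : UnitAddCircle), AddCircle.continuous_mk' 1⟩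

theorem exists_fundamental_class : ∃ ε : SchottkyShift.H₁ UnitAddCircle,
    ofH₁ UnitAddCircle ε = segment circleLine 0 1 ∧ Submodule.span ℤ {ε} = ⊤ := by
  obtain ⟨ε, hε⟩ := exists_H₁_of_cycle (single (circleLine.comp (affinePath 0 1))) (by
    rw [bd_single_one, sub_eq_zero]
    congr 2
    change ((affinePath 0 1 (stdSimplex.vertex 1) : ℝ) : UnitAddCircle) =
      ((affinePath 0 1 (stdSimplex.vertex 0) : ℝ) : UnitAddCircle)
    rw [affinePath_vertex_zero, affinePath_vertex_one]
    exact AddCircle.coe_period 1)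
  refine ⟨ε, hε, Submodule.eq_top_iff'.2 fun x => ?_⟩
  obtain ⟨c, hc, hx⟩ := exists_cycle_of_H₁ x
  have h1 := isLineSystem_circle.classOf_mem_span c hc
  have h2 : Submodule.span ℤ (Set.range (loopClass (1 : Equiv.Perm Unit) fun _ => circleLine)) ≤
      (Submodule.span ℤ {ε}).map (ofH₁ UnitAddCircle) := by
    rw [Submodule.span_le]
    rintro _ ⟨a, rfl⟩
    refine ⟨ε, Submodule.mem_span_singleton_self ε, ?_⟩
    have h3 : Function.minimalPeriod (1 : Equiv.Perm Unit) a = 1 :=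
      Function.minimalPeriod_eq_one_iff_isFixedPt.2 rfl
    rw [hε, loopClass, h3, Nat.cast_one]
    rfl
  obtain ⟨y, hy, hyx⟩ := h2 h1
  rwa [← ofH₁_injective (hyx.trans hx.symm)]

end SingularChains

namespace SchottkyShift
open SingularChains
variable {g : ℕ} {ε : H₁ UnitAddCircle}

theorem ofH₁_curveClass (hε : ofH₁ UnitAddCircle ε = segment circleLine 0 1) (x : Seq g) (N : ℕ)
    (h : (shift g)^[N] x = x) :
    ofH₁ (MappingTorus g) (curveClass ε x N h) = segment (lineMap x) 0 N := by
  rw [curveClass, ofH₁_map, hε, mapClass_segment, SingularChains.segment]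
  have h1 : ((closedCurve x N h).comp circleLine).comp (affinePath 0 1) =
      (lineMap x).comp (affinePath 0 N) := by
    ext u
    change line x (N * affinePath 0 1 u) = line x (affinePath 0 N u)
    congr 1
    change (N : ℝ) * (0 * u 0 + 1 * u 1) = 0 * u 0 + N * u 1
    ring
  rw [h1, SingularChains.segment]

theorem ofH₁_orbitClass (hε : ofH₁ UnitAddCircle ε = segment circleLine 0 1) (x : PeriodicSeq g) :
    ofH₁ (MappingTorus g) (orbitClass ε x) = loopClass (shift g).toEquiv lineMap x.1 :=
  ofH₁_curveClass hε _ _ _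

theorem orbitClass_eq_of_rel (hε : ofH₁ UnitAddCircle ε = segment circleLine 0 1)
    {x y : PeriodicSeq g} (h : (periodicSetoid g).r x y) : orbitClass ε x = orbitClass ε y := by
  refine ofH₁_injective ?_
  rw [ofH₁_orbitClass hε, ofH₁_orbitClass hε]
  exact (isLineSystem_mappingTorus g).loopClass_eq_of_sameCycle h

/-- The class of a periodic orbit. -/
def PeriodicOrbit.homologyClass (hε : ofH₁ UnitAddCircle ε = segment circleLine 0 1) :
    PeriodicOrbit g → H₁ (MappingTorus g) :=
  Quotient.lift (orbitClass ε) fun _ _ => orbitClass_eq_of_rel hε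

/-- The length cocycle sends each orbit class to its nonzero period times the indicator of that
orbit, and such vectors are independent. -/
theorem linearIndependent_homologyClass (hε : ofH₁ UnitAddCircle ε = segment circleLine 0 1) :
    LinearIndependent ℤ (PeriodicOrbit.homologyClass (g := g) hε) := by
  classical
  obtain ⟨Ψ, hΨ⟩ := (isLineSystem_mappingTorus g).exists_dual
  let ι : PeriodicOrbit g → Orbits (shift g).toEquiv :=
    Quotient.map' Subtype.val fun _ _ h => h
  have hι : Function.Injective ι := by
    rintro ⟨x⟩ ⟨y⟩ h
    exact Quotient.sound (s := periodicSetoid g)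
      (Quotient.exact (s := Equiv.Perm.SameCycle.setoid (shift g).toEquiv) h)
  have hval : ∀ o, ∃ N : ℝ, N ≠ 0 ∧
      Ψ (ofH₁ _ (PeriodicOrbit.homologyClass hε o)) = Pi.single (ι o) N := by
    rintro ⟨x⟩
    refine ⟨Function.minimalPeriod (shift g) x.1, ?_, ?_⟩
    · exact_mod_cast (Function.minimalPeriod_pos_of_mem_periodicPts x.2).ne'
    · refine (congrArg Ψ (ofH₁_orbitClass hε x)).trans ((hΨ _ _ _).trans ?_)
      rw [sub_zero]
      simp only [Pi.single]
      congr!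
  choose N hN hΨN using hval
  refine LinearIndependent.of_comp (Ψ ∘ₗ ofH₁ (MappingTorus g)) ?_
  have hcomp : (Ψ ∘ₗ ofH₁ (MappingTorus g)) ∘ PeriodicOrbit.homologyClass hε =
      fun o => Pi.single (ι o) (N o) := funext hΨN
  rw [hcomp, linearIndependent_iff']
  intro s c hc o ho
  have h1 := congrFun hc (ι o)
  rw [Finset.sum_apply, Finset.sum_eq_single o] at h1
  · rw [Pi.smul_apply, Pi.single_eq_same, Pi.zero_apply, zsmul_eq_mul] at h1
    exact_mod_cast (mul_eq_zero.1 h1).resolve_right (hN o)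
  · intro o' _ hne
    rw [Pi.smul_apply, Pi.single_eq_of_ne (fun h => hne (hι h).symm), smul_zero]
  · exact fun h => (h ho).elim

theorem span_range_homologyClass (hε : ofH₁ UnitAddCircle ε = segment circleLine 0 1) :
    ⊤ ≤ Submodule.span ℤ (Set.range (PeriodicOrbit.homologyClass (g := g) hε)) := by
  intro x _
  obtain ⟨c, hc, hx⟩ := exists_cycle_of_H₁ x
  have h1 := (isLineSystem_mappingTorus g).classOf_mem_span c hc
  have h2 : Submodule.span ℤ (Set.range (loopClass (shift g).toEquiv lineMap)) ≤
      (Submodule.span ℤ (Set.range (PeriodicOrbit.homologyClass (g := g) hε))).map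
        (ofH₁ (MappingTorus g)) := by
    rw [Submodule.span_le]
    rintro _ ⟨a, rfl⟩
    by_cases ha : a ∈ Function.periodicPts (shift g)
    · exact ⟨orbitClass ε ⟨a, ha⟩, Submodule.subset_span ⟨Quotient.mk _ ⟨a, ha⟩, rfl⟩,
        ofH₁_orbitClass hε ⟨a, ha⟩⟩
    -- For an aperiodic line the default period `0` makes the loop degenerate, so it contributes
    -- nothing.
    · have h3 : Function.minimalPeriod (shift g).toEquiv a = 0 :=
        Function.minimalPeriod_eq_zero_of_notMem_periodicPts ha
      rw [loopClass, h3, Nat.cast_zero, segment_self]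
      exact zero_mem _
  obtain ⟨y, hy, hyx⟩ := h2 h1
  rwa [← ofH₁_injective (hyx.trans hx.symm)]

/-- The closed orbits form a basis of the first homology of the mapping torus. -/
def orbitBasis (hε : ofH₁ UnitAddCircle ε = segment circleLine 0 1) :
    Module.Basis (PeriodicOrbit g) ℤ (H₁ (MappingTorus g)) :=
  Module.Basis.mk (linearIndependent_homologyClass hε) (span_range_homologyClass hε)

theorem orbitBasis_orbit (hε : ofH₁ UnitAddCircle ε = segment circleLine 0 1) (x : PeriodicSeq g) :
    orbitBasis hε x.orbit = orbitClass ε x := by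
  rw [orbitBasis, Module.Basis.mk_apply]
  rfl

theorem CyclicWord.periodic_rep {N M : ℕ} (h : N + 1 ∣ M + 1) (a : CyclicWord g N) :
    (CyclicWord.rep h a).periodic = a.periodic := by
  ext1; funext i
  change a.1 (ZMod.castHom h (ZMod (N + 1)) ((i : ℤ) : ZMod (M + 1))) = a.1 _
  rw [map_intCast]

/-- Repeating a word leaves its periodic sequence unchanged; only the time of travel is multiplied
by `k`. -/
theorem toH₁_J (hε : ofH₁ UnitAddCircle ε = segment circleLine 0 1) (N M k : ℕ)
    (h : N + 1 ∣ M + 1) (hk : M + 1 = k * (N + 1)) (u : WordGroup g N) :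
    WordGroup.toH₁ ε M (J g h u) = (k : ℤ) • WordGroup.toH₁ ε N u := by
  induction u using Finsupp.induction_linear with
  | zero => simp
  | add u v hu hv => rw [map_add, map_add, map_add, hu, hv, zsmul_add]
  | single a c =>
    have h1 : J g h (Finsupp.single a c) = Finsupp.single (CyclicWord.rep h a) c :=
      Finsupp.mapDomain_single
    rw [h1, WordGroup.toH₁, WordGroup.toH₁, Finsupp.linearCombination_single,
      Finsupp.linearCombination_single, smul_comm]
    congr 1
    refine ofH₁_injective ?_
    rw [ofH₁_curveClass hε]
    refine Eq.trans ?_ (map_zsmul (ofH₁ (MappingTorus g)) (k : ℤ) _).symm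
    rw [ofH₁_curveClass hε, CyclicWord.periodic_rep]
    have h2 := (isLineSystem_mappingTorus g).segment_mul a.periodic ((N + 1 : ℕ) : ℤ) (by
      rw [zpow_natCast, Equiv.Perm.coe_pow]
      exact a.iterate_periodic) k
    rw [← Int.cast_natCast (N + 1), ← h2, hk]
    push_cast
    rfl

end SchottkyShift
end

/-! ### Counting cyclic words and periodic orbits -/

noncomputable section
namespace SchottkyShift
variable {g : ℕ}

/-- The arbitrary weight `f` on the endpoints makes the induction go through: removing the first
letter absorbs its transition into the weight. Closing the path with the weight `A b a` then gives
the trace. -/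
theorem sum_prod_path_eq_pow {L : Type} [Fintype L] [DecidableEq L] (A : Matrix L L ℤ) (n : ℕ)
    (f : L → L → ℤ) :
    ∑ w : Fin (n + 1) → L, (∏ i : Fin n, A (w i.castSucc) (w i.succ)) * f (w 0) (w (Fin.last n)) =
      ∑ a, ∑ b, f a b * (A ^ n) a b := by
  induction n generalizing f with
  | zero =>
    rw [← (Equiv.funUnique (Fin 1) L).symm.sum_comp]
    simp [Matrix.one_apply]
  | succ n ih =>
    rw [← (Fin.consEquiv fun _ => L).sum_comp, Fintype.sum_prod_type_right]
    have h1 : ∀ (v : Fin (n + 1) → L) (a : L),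
        (∏ i : Fin (n + 1), A ((Fin.consEquiv fun _ => L) (a, v) i.castSucc)
          ((Fin.consEquiv fun _ => L) (a, v) i.succ)) *
          f ((Fin.consEquiv fun _ => L) (a, v) 0)
            ((Fin.consEquiv fun _ => L) (a, v) (Fin.last (n + 1))) =
        (∏ i : Fin n, A (v i.castSucc) (v i.succ)) * (A a (v 0) * f a (v (Fin.last n))) := by
      intro v a
      rw [Fin.prod_univ_succ]
      simp only [Fin.consEquiv_apply, Fin.castSucc_zero, Fin.cons_zero, Fin.cons_succ,
        ← Fin.succ_castSucc, ← Fin.succ_last]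
      ring
    simp only [h1, ← Finset.mul_sum]
    rw [ih fun c b => ∑ a, A a c * f a b]
    simp only [pow_succ', Matrix.mul_apply, Finset.sum_mul, Finset.mul_sum]
    rw [Finset.sum_comm]
    conv_rhs => rw [Finset.sum_comm]
    refine Finset.sum_congr rfl fun b _ => ?_
    rw [Finset.sum_comm]
    refine Finset.sum_congr rfl fun a _ => Finset.sum_congr rfl fun c _ => ?_
    ring

theorem sum_prod_cycle_eq_trace {L : Type} [Fintype L] [DecidableEq L] (A : Matrix L L ℤ) (n : ℕ) :
    ∑ w : Fin (n + 1) → L, ∏ i, A (w i) (w (i + 1)) = (A ^ (n + 1)).trace := by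
  have h := sum_prod_path_eq_pow A n fun a b => A b a
  have h1 : ∀ w : Fin (n + 1) → L, ∏ i, A (w i) (w (i + 1)) =
      (∏ i : Fin n, A (w i.castSucc) (w i.succ)) * A (w (Fin.last n)) (w 0) := by
    intro w
    rw [Fin.prod_univ_castSucc, Fin.last_add_one]
    simp only [Fin.coeSucc_eq_succ]
  simp only [h1, h, pow_succ', Matrix.trace, Matrix.diag, Matrix.mul_apply]
  rw [Finset.sum_comm]

/-- The transition matrix of the shift. -/
def transition (g : ℕ) : Matrix (Letter g) (Letter g) ℤ :=
  Matrix.of fun a b => if b = a.inv then 0 else 1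

theorem Letter.inv_inv (a : Letter g) : a.inv.inv = a := by
  simp [Letter.inv]

theorem Letter.inv_ne (a : Letter g) : a.inv ≠ a := by
  intro h
  have := congrArg Prod.snd h
  simp [Letter.inv] at this

/-- The constant part of the entries of the powers of the transition matrix. -/
def transitionConst (g : ℕ) : ℕ → ℤ
  | 0 => 0
  | n + 1 => (2 * g - 1) * transitionConst g n + (-1) ^ n

theorem mul_transitionConst (n : ℕ) :
    2 * (g : ℤ) * transitionConst g n = (2 * g - 1) ^ n - (-1) ^ n := by
  induction n with
  | zero => simp [transitionConst]
  | succ n ih =>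
    rw [transitionConst, pow_succ, pow_succ]
    linear_combination (2 * (g : ℤ) - 1) * ih

/-- The transition matrix is the all-ones matrix minus the permutation matrix of inversion, an
involution; every power is a multiple of the first plus a signed power of the second. -/
theorem transition_pow (n : ℕ) (a b : Letter g) :
    (transition g ^ n) a b = transitionConst g n +
      (-1) ^ n * (if Even n then (if a = b then 1 else 0) else (if b = a.inv then 1 else 0)) := by
  induction n generalizing a b with
  | zero => simp [transitionConst, Matrix.one_apply]
  | succ n ih =>
    have h1 : ∀ c, transition g a c = 1 - (if c = a.inv then 1 else 0) := by
      intro c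
      rw [transition, Matrix.of_apply]
      split_ifs <;> rfl
    have h2 : ∀ c : Letter g, (b = c.inv) = (c = b.inv) := by
      intro c
      refine propext ⟨?_, ?_⟩ <;> rintro rfl <;> rw [Letter.inv_inv]
    have h3 : ∑ c, (transition g ^ n) c b = 2 * g * transitionConst g n + (-1) ^ n := by
      simp only [ih, Finset.sum_add_distrib, ← Finset.mul_sum, h2]
      split_ifs <;> simp [mul_assoc, mul_left_comm]
    rw [pow_succ', Matrix.mul_apply]
    simp only [h1, sub_mul, one_mul, Finset.sum_sub_distrib, h3, ite_mul, zero_mul,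
      Finset.sum_ite_eq', Finset.mem_univ, if_true]
    simp only [ih, transitionConst, Nat.even_add_one, Letter.inv_inv]
    by_cases hn : Even n
    · simp only [hn, if_true, not_true, if_false, pow_succ, eq_comm (a := a.inv)]
      ring
    · simp only [hn, not_false_eq_true, if_true, if_false, pow_succ, eq_comm (a := a)]
      ring

/-- The parity term is the trace of the power of the inversion matrix: all `2 * g` letters count
when the power is even, none when it is odd, since no letter is its own inverse. -/
theorem card_cyclicWord (g N : ℕ) :
    (Fintype.card (CyclicWord g N) : ℤ) =
      (2 * g - 1) ^ (N + 1) + g + (-1) ^ (N + 1) * (g - 1) := by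
  have h1 : (Fintype.card (CyclicWord g N) : ℤ) = (transition g ^ (N + 1)).trace := by
    rw [← sum_prod_cycle_eq_trace, Fintype.card_subtype, Finset.card_filter]
    push_cast
    refine Finset.sum_congr rfl fun w _ => ?_
    simp only [transition, Matrix.of_apply]
    split_ifs with h
    · exact (Finset.prod_eq_one fun i _ => if_neg (h i)).symm
    · push Not at h
      obtain ⟨i, hi⟩ := h
      refine (Finset.prod_eq_zero (Finset.mem_univ i) ?_).symm
      exact if_pos hi
  have h2 := mul_transitionConst (g := g) (N + 1)
  rw [h1, Matrix.trace]
  simp only [Matrix.diag, transition_pow, (Letter.inv_ne _).symm]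
  by_cases hn : Even (N + 1)
  · simp [hn, hn.neg_one_pow] at h2 ⊢
    linear_combination h2
  · simp [hn, (Nat.not_even_iff_odd.1 hn).neg_one_pow] at h2 ⊢
    linear_combination h2

theorem card_cyclicWord_of_even {N : ℕ} (hg : 1 ≤ g) (hN : Even N) :
    Fintype.card (CyclicWord g N) = (2 * g - 1) ^ (N + 1) + 1 := by
  have h := card_cyclicWord g N
  rw [(hN.add_one).neg_one_pow] at h
  zify [show 1 ≤ 2 * g by omega]
  linear_combination h

theorem card_cyclicWord_of_odd {N : ℕ} (hg : 1 ≤ g) (hN : Odd N) :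
    Fintype.card (CyclicWord g N) = (2 * g - 1) ^ (N + 1) + (2 * g - 1) := by
  have h := card_cyclicWord g N
  rw [(hN.add_one).neg_one_pow] at h
  zify [show 1 ≤ 2 * g by omega]
  linear_combination h

theorem Seq.apply_add_mul {x : Seq g} {n : ℕ} (h : (shift g)^[n] x = x) (k l : ℤ) :
    x.1 (k + l * n) = x.1 k := by
  have h1 : Function.Periodic x.1 (n : ℤ) := fun k => by
    rw [← shift_iterate_apply, h]
  exact h1.int_mul l k

theorem Seq.apply_eq_of_cast_eq {x : Seq g} {N : ℕ} (h : (shift g)^[N + 1] x = x) {k l : ℤ}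
    (hkl : (k : ZMod (N + 1)) = l) : x.1 k = x.1 l := by
  rw [ZMod.intCast_eq_intCast_iff_dvd_sub] at hkl
  obtain ⟨m, hm⟩ := hkl
  rw [← Seq.apply_add_mul h k m, mul_comm, ← hm, add_sub_cancel]

theorem CyclicWord.periodic_injective (N : ℕ) :
    Function.Injective (CyclicWord.periodic : CyclicWord g N → Seq g) := by
  intro a b h
  ext1; funext i
  obtain ⟨k, rfl⟩ := ZMod.intCast_surjective i
  exact congrFun (congrArg Subtype.val h) k

theorem CyclicWord.exists_periodic_eq {N : ℕ} {x : Seq g} (h : (shift g)^[N + 1] x = x) :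
    ∃ a : CyclicWord g N, a.periodic = x := by
  refine ⟨⟨fun i => x.1 (i.cast : ℤ), fun i => ?_⟩, ?_⟩
  · have h1 := Seq.apply_eq_of_cast_eq h (k := ((i + 1).cast : ℤ)) (l := (i.cast : ℤ) + 1)
      (by push_cast; simp)
    change x.1 ((i + 1).cast : ℤ) ≠ _
    rw [h1]
    exact x.2 _
  · ext1; funext k
    exact Seq.apply_eq_of_cast_eq h (by simp)

/-- Cyclically reduced words of length `N + 1` are the same as points of period `N + 1`. -/
def CyclicWord.equivFixed (g N : ℕ) :
    CyclicWord g N ≃ {x : Seq g // (shift g)^[N + 1] x = x} :=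
  Equiv.ofBijective (fun a => ⟨a.periodic, a.iterate_periodic⟩)
    ⟨fun _ _ h => CyclicWord.periodic_injective N (congrArg Subtype.val h), fun x => by
      obtain ⟨a, ha⟩ := CyclicWord.exists_periodic_eq x.2
      exact ⟨a, Subtype.ext ha⟩⟩

instance (n : ℕ) [NeZero n] : Finite {x : Seq g // (shift g)^[n] x = x} := by
  obtain ⟨N, rfl⟩ := Nat.exists_eq_succ_of_ne_zero (NeZero.ne n)
  exact Finite.of_equiv _ (CyclicWord.equivFixed g N)

/-- The exact period of a periodic orbit. -/
def PeriodicOrbit.period : PeriodicOrbit g → ℕ :=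
  Quotient.lift (fun x : PeriodicSeq g => Function.minimalPeriod (shift g) x.1) (by
    rintro x y ⟨n, hn⟩
    rw [← hn]
    exact (SingularChains.minimalPeriod_zpow_apply (shift g).toEquiv n x.1).symm)

theorem PeriodicOrbit.period_pos (o : PeriodicOrbit g) : 0 < o.period := by
  obtain ⟨x⟩ := o
  exact Function.minimalPeriod_pos_of_mem_periodicPts x.2

theorem mem_periodicPts_of_minimalPeriod_eq {x : Seq g} {d : ℕ} (hd : 0 < d)
    (h : Function.minimalPeriod (shift g) x = d) : x ∈ Function.periodicPts (shift g) :=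
  Function.minimalPeriod_pos_iff_mem_periodicPts.1 (h ▸ hd)

instance (d : ℕ) : Finite {x : Seq g // Function.minimalPeriod (shift g) x = d ∧ 0 < d} := by
  rcases Nat.eq_zero_or_pos d with rfl | hd
  · exact Finite.of_injective (β := Empty) (fun x => (x.2.2.false).elim) fun x => x.2.2.false.elim
  · have : NeZero d := ⟨hd.ne'⟩
    refine Finite.of_injective
      (fun x => (⟨x.1, by
        have h := Function.isPeriodicPt_minimalPeriod (shift g) x.1
        rw [x.2.1] at h
        exact h⟩ : {x : Seq g // (shift g)^[d] x = x}))
      fun x y h => Subtype.ext (congrArg (fun z => z.1) h)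

instance (d : ℕ) : Finite {o : PeriodicOrbit g // o.period = d} := by
  refine Finite.of_injective (β := {x : Seq g // Function.minimalPeriod (shift g) x = d ∧ 0 < d})
    (fun o => ⟨(Quotient.out o.1 : PeriodicSeq g).1, ?_, o.2 ▸ o.1.period_pos⟩) ?_
  · have h := o.2
    rw [← Quotient.out_eq o.1] at h
    exact h
  · intro o o' h
    have h1 : Quotient.out o.1 = Quotient.out o'.1 := Subtype.ext (congrArg (fun z => z.1) h)
    exact Subtype.ext ((Quotient.out_eq o.1).symm.trans
      ((congrArg (Quotient.mk _) h1).trans (Quotient.out_eq o'.1)))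

/-- The number of periodic orbits of exact period `d`. -/
def orbitCount (g d : ℕ) : ℕ := Nat.card {o : PeriodicOrbit g // o.period = d}

/-- An orbit of period `d` consists of the `d` distinct iterates of a representative. -/
theorem card_minimalPeriod_eq (g : ℕ) {d : ℕ} (hd : 0 < d) :
    Nat.card {x : Seq g // Function.minimalPeriod (shift g) x = d} = d * orbitCount g d := by
  have hper : ∀ o : PeriodicOrbit g,
      Function.minimalPeriod (shift g) (Quotient.out o : PeriodicSeq g).1 = o.period := by
    intro o
    conv_rhs => rw [← Quotient.out_eq o]
    rfl
  let f : {o : PeriodicOrbit g // o.period = d} × Fin d →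
      {x : Seq g // Function.minimalPeriod (shift g) x = d} := fun p =>
    ⟨(shift g)^[p.2] (Quotient.out p.1.1 : PeriodicSeq g).1, by
      rw [Function.minimalPeriod_apply_iterate (Quotient.out p.1.1 : PeriodicSeq g).2, hper, p.1.2]⟩
  have hf : Function.Bijective f := by
    constructor
    · rintro ⟨⟨o, ho⟩, i⟩ ⟨⟨o', ho'⟩, j⟩ h
      have h1 : (shift g)^[i] (Quotient.out o : PeriodicSeq g).1 =
        (shift g)^[j] (Quotient.out o' : PeriodicSeq g).1 := congrArg (fun z => z.1) h
      have h2 : o = o' := by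
        rw [← Quotient.out_eq o, ← Quotient.out_eq o']
        refine Quotient.sound ?_
        have h3 : ∀ (n : ℕ) (x : Seq g),
            Equiv.Perm.SameCycle (shift g).toEquiv x ((shift g)^[n] x) := fun n x =>
          ⟨n, by rw [zpow_natCast, Equiv.Perm.coe_pow]; rfl⟩
        have h4 := h3 i (Quotient.out o : PeriodicSeq g).1
        rw [h1] at h4
        exact h4.trans (h3 j _).symm
      subst h2
      have h5 := Function.iterate_injOn_Iio_minimalPeriod (f := shift g)
        (x := (Quotient.out o : PeriodicSeq g).1)
        (by rw [hper, ho]; exact i.2) (by rw [hper, ho]; exact j.2) h1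
      rw [Fin.ext h5]
    · rintro ⟨x, hx⟩
      let p : PeriodicSeq g := ⟨x, mem_periodicPts_of_minimalPeriod_eq hd hx⟩
      have hp : (Quotient.out p.orbit).orbit = p.orbit := Quotient.out_eq _
      have hpp : p.orbit.period = d := hx
      obtain ⟨n, hn⟩ : Equiv.Perm.SameCycle (shift g).toEquiv (Quotient.out p.orbit).1 x :=
        Quotient.exact hp
      have hd' : (0 : ℤ) < d := by exact_mod_cast hd
      refine ⟨⟨⟨p.orbit, hpp⟩, ⟨(n % d).toNat, ?_⟩⟩, Subtype.ext ?_⟩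
      · have := Int.emod_lt_of_pos n hd'
        omega
      · change (shift g)^[(n % d).toNat] (Quotient.out p.orbit).1 = x
        have h1 := MulAction.zpow_smul_mod_minimalPeriod (a := (shift g).toEquiv)
          (b := (Quotient.out p.orbit).1) n
        have h2 : Function.minimalPeriod ((shift g).toEquiv • ·) (Quotient.out p.orbit).1 = d :=
          (hper _).trans hpp
        rw [h2] at h1
        have h3 : ((n % d).toNat : ℤ) = n % d := Int.toNat_of_nonneg (Int.emod_nonneg _ hd'.ne')
        rw [← h3, zpow_natCast] at h1
        rw [← hn]
        refine Eq.trans ?_ h1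
        rw [Equiv.Perm.smul_def, Equiv.Perm.coe_pow]
        rfl
  rw [← Nat.card_congr (Equiv.ofBijective f hf), Nat.card_prod, Nat.card_fin, mul_comm, orbitCount]

theorem card_fixed (g : ℕ) {n : ℕ} (hn : 0 < n) :
    Nat.card {x : Seq g // (shift g)^[n] x = x} = ∑ d ∈ n.divisors, d * orbitCount g d := by
  have : NeZero n := ⟨hn.ne'⟩
  have e : {x : Seq g // (shift g)^[n] x = x} ≃
      Σ d : n.divisors, {x : Seq g // Function.minimalPeriod (shift g) x = d} :=
    { toFun := fun x => ⟨⟨Function.minimalPeriod (shift g) x.1, Nat.mem_divisors.2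
        ⟨Function.IsPeriodicPt.minimalPeriod_dvd x.2, hn.ne'⟩⟩, x.1, rfl⟩
      invFun := fun x => ⟨x.2.1, (Function.isPeriodicPt_iff_minimalPeriod_dvd.2 (by
        rw [x.2.2]
        exact Nat.dvd_of_mem_divisors x.1.2) : Function.IsPeriodicPt (shift g) n x.2.1)⟩
      left_inv := fun _ => rfl
      right_inv := by
        rintro ⟨⟨d, hd⟩, x, hx⟩
        change _ = d at hx
        subst hx
        rfl }
  have : ∀ d : n.divisors, Finite {x : Seq g // Function.minimalPeriod (shift g) x = d} := by
    intro d
    have h := Nat.pos_of_mem_divisors d.2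
    refine Finite.of_injective
      (β := {x : Seq g // Function.minimalPeriod (shift g) x = d ∧ 0 < d.1})
      (fun x => ⟨x.1, x.2, h⟩) fun x y h => Subtype.ext (congrArg (fun z => z.1) h)
  rw [Nat.card_congr e, Nat.card_sigma, ← Finset.sum_coe_sort n.divisors fun d => d * orbitCount g d]
  exact Finset.sum_congr rfl fun d _ => card_minimalPeriod_eq g (Nat.pos_of_mem_divisors d.2)

theorem sum_mul_orbitCount (g : ℕ) {n : ℕ} (hn : 0 < n) :
    ∑ d ∈ n.divisors, (d : ℤ) * orbitCount g d = (2 * g - 1) ^ n + g + (-1) ^ n * (g - 1) := by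
  obtain ⟨N, rfl⟩ := Nat.exists_eq_succ_of_ne_zero hn.ne'
  have h1 := card_fixed g hn
  have h2 := card_cyclicWord g N
  rw [← Nat.card_eq_fintype_card, Nat.card_congr (CyclicWord.equivFixed g N)] at h2
  rw [← h2]
  change _ = ((Nat.card {x : Seq g // (shift g)^[N.succ] x = x} : ℕ) : ℤ)
  rw [h1]
  push_cast
  rfl

theorem orbitCount_one (g : ℕ) : orbitCount g 1 = 2 * g := by
  have h := sum_mul_orbitCount g one_pos
  rw [Nat.divisors_one, Finset.sum_singleton] at h
  zify
  push_cast at h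
  linear_combination h

theorem orbitCount_two (hg : 1 ≤ g) : orbitCount g 2 = 2 * g * (g - 1) := by
  have h := sum_mul_orbitCount g two_pos
  rw [Nat.Prime.sum_divisors Nat.prime_two, orbitCount_one] at h
  zify [hg]
  push_cast at h
  have h' : 2 * (orbitCount g 2 : ℤ) = 2 * (2 * g * (g - 1)) := by linear_combination h
  omega

theorem orbitCount_eq {N : ℕ} (hN : 2 < N) :
    (orbitCount g N : ℚ) = 1 / N * ∑ d ∈ N.divisors, (ArithmeticFunction.moebius d : ℚ) *
      (2 * g - 1 : ℚ) ^ (N / d) := by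
  -- The fixed-point count exceeds `(2 * g - 1) ^ n` by `1`, plus `2 * (g - 1)` when `n` is even.
  -- Removing these terms at the divisors `1` and `2` leaves a pure power to invert, and changes
  -- nothing for `N > 2`.
  let F : ℕ → ℚ := fun i => i * orbitCount g i - (if i = 1 then 1 else 0) -
    (if i = 2 then 2 * ((g : ℚ) - 1) else 0)
  have hF : ∀ n > 0, ∑ i ∈ n.divisors, F i = (2 * g - 1 : ℚ) ^ n := by
    intro n hn
    have h := sum_mul_orbitCount g hn
    have h' : (∑ d ∈ n.divisors, (d : ℚ) * orbitCount g d) =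
      (2 * g - 1) ^ n + g + (-1) ^ n * (g - 1) := by exact_mod_cast h
    simp only [F, Finset.sum_sub_distrib, h', Finset.sum_ite_eq', Nat.mem_divisors, one_dvd,
      hn.ne', ne_eq, not_false_eq_true, if_true, and_true]
    by_cases h2 : 2 ∣ n
    · rw [if_pos h2, (even_iff_two_dvd.2 h2).neg_one_pow]
      ring
    · rw [if_neg h2, (Nat.odd_iff.2 (by omega)).neg_one_pow]
      ring
  have h1 := ArithmeticFunction.sum_eq_iff_sum_mul_moebius_eq.1 hF N (by omega)
  rw [Nat.sum_divisorsAntidiagonal fun d e =>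
    (ArithmeticFunction.moebius d : ℚ) * (2 * g - 1 : ℚ) ^ e] at h1
  rw [h1]
  have h2 : (N : ℚ) ≠ 0 := by positivity
  simp only [F]
  rw [if_neg (by omega), if_neg (by omega)]
  field_simp
  ring

instance : Countable (PeriodicSeq g) := by
  have : (Function.periodicPts (shift g)).Countable := by
    refine Set.Countable.mono (s₂ := ⋃ n : ℕ, {x | (shift g)^[n + 1] x = x}) ?_
      (Set.countable_iUnion fun n => ?_)
    · rintro x ⟨n, hn, hx⟩
      obtain ⟨N, rfl⟩ := Nat.exists_eq_succ_of_ne_zero (ne_of_gt hn)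
      exact Set.mem_iUnion.2 ⟨N, hx⟩
    · exact Set.Finite.countable (inferInstanceAs (Finite {x : Seq g // (shift g)^[n + 1] x = x}))
  exact this.to_subtype

instance : Countable (PeriodicOrbit g) :=
  inferInstanceAs (Countable (Quotient (periodicSetoid g)))

theorem infinite_periodicOrbit (hg : 2 ≤ g) : Infinite (PeriodicOrbit g) := by
  have key : ∀ n : ℕ, ∃ o : PeriodicOrbit g, o.period = n + 1 := by
    intro n
    -- One generator at the multiples of `n + 1` and another elsewhere: no inverse letters occur, so
    -- the sequence is reduced, and its exact period is `n + 1`.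
    let x : Seq g := ⟨fun k => if ((n + 1 : ℕ) : ℤ) ∣ k then (⟨1, by omega⟩, true)
      else (⟨0, by omega⟩, true), fun k h => by
        have := congrArg Prod.snd h
        simp only [Letter.inv] at this
        split_ifs at this <;> simp at this⟩
    have hx : ∀ m : ℕ, (shift g)^[m] x = x ↔ n + 1 ∣ m := by
      intro m
      constructor
      · intro h
        have h1 := congrFun (congrArg Subtype.val h) 0
        rw [shift_iterate_apply] at h1
        by_contra h2
        have h3 : ¬ ((n + 1 : ℕ) : ℤ) ∣ 0 + m := by
          rwa [zero_add, Int.natCast_dvd_natCast]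
        simp only [x, if_neg h3, dvd_zero, if_true] at h1
        simpa using congrArg (fun z => z.1.val) h1
      · intro h
        ext1; funext k
        rw [shift_iterate_apply]
        have : ((n + 1 : ℕ) : ℤ) ∣ k + m ↔ ((n + 1 : ℕ) : ℤ) ∣ k :=
          dvd_add_left (Int.natCast_dvd_natCast.2 h)
        simp only [x, this]
    have hm : Function.minimalPeriod (shift g) x = n + 1 :=
      Nat.dvd_antisymm (Function.IsPeriodicPt.minimalPeriod_dvd ((hx _).2 dvd_rfl))
        ((hx _).1 Function.iterate_minimalPeriod)
    exact ⟨PeriodicSeq.orbit ⟨x, mem_periodicPts_of_minimalPeriod_eq n.succ_pos hm⟩, hm⟩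
  choose o ho using key
  refine Infinite.of_injective o fun m n h => ?_
  have := congrArg PeriodicOrbit.period h
  rw [ho, ho] at this
  omega

end SchottkyShift
end

/-! ### The direct limit and the decomposition by exact period -/

noncomputable section
namespace SchottkyShift
open SingularChains
variable {g : ℕ} {ε : H₁ UnitAddCircle}

/-- The periodic sequence of a cyclically reduced word, as a periodic point of the shift. -/
def CyclicWord.toPeriodicSeq {N : ℕ} (a : CyclicWord g N) : PeriodicSeq g :=
  ⟨a.periodic, N + 1, N.succ_pos, a.iterate_periodic⟩

theorem CyclicWord.toPeriodicSeq_injective (N : ℕ) :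
    Function.Injective (CyclicWord.toPeriodicSeq : CyclicWord g N → PeriodicSeq g) := fun _ _ h =>
  CyclicWord.periodic_injective N (congrArg Subtype.val h)

instance : IsDirectedOrder LengthIndex where
  directed i j := by
    obtain ⟨k, hk⟩ := Nat.exists_eq_succ_of_ne_zero
      (Nat.mul_pos i.idx.succ_pos j.idx.succ_pos).ne'
    exact ⟨⟨k⟩, ⟨j.idx + 1, hk.symm⟩, ⟨i.idx + 1, hk.symm.trans (mul_comm _ _)⟩⟩

/-- The map from the direct limit of the word groups to the free group on periodic sequences. -/
def limitMap (g : ℕ) : WordLimit g →ₗ[ℤ] (PeriodicSeq g →₀ ℤ) :=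
  Module.DirectLimit.lift ℤ LengthIndex (fun N : LengthIndex => WordGroup g N.idx)
    (fun _ _ (h : _ ≤ _) => J g h) (fun _ => Finsupp.lmapDomain ℤ ℤ CyclicWord.toPeriodicSeq)
    fun i j hij u => by
      simp only [J, Finsupp.lmapDomain_apply, ← Finsupp.mapDomain_comp]
      congr 1
      funext a
      exact Subtype.ext (CyclicWord.periodic_rep hij a)

theorem limitMap_toLimit (N : ℕ) (u : WordGroup g N) :
    limitMap g (WordGroup.toLimit g N u) = Finsupp.mapDomain CyclicWord.toPeriodicSeq u :=
  Module.DirectLimit.lift_of _ _ _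

theorem toLimit_injective (g N : ℕ) : Function.Injective (WordGroup.toLimit g N) := by
  intro u v h
  have h1 := congrArg (limitMap g) h
  rw [limitMap_toLimit, limitMap_toLimit] at h1
  exact Finsupp.mapDomain_injective (CyclicWord.toPeriodicSeq_injective N) h1

/-- Words of one length are distinguished by their periodic sequences, so each stage injects; every
periodic sequence comes from some word. -/
theorem limitMap_bijective (g : ℕ) : Function.Bijective (limitMap g) := by
  constructor
  · exact Module.DirectLimit.lift_injective _ _ fun i =>
      Finsupp.mapDomain_injective (CyclicWord.toPeriodicSeq_injective i.idx)
  · intro u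
    induction u using Finsupp.induction_linear with
    | zero => exact ⟨0, map_zero _⟩
    | add u v hu hv =>
      obtain ⟨x, rfl⟩ := hu
      obtain ⟨y, rfl⟩ := hv
      exact ⟨x + y, map_add _ _ _⟩
    | single x c =>
      obtain ⟨x, n, hn, hx⟩ := x
      obtain ⟨N, rfl⟩ := Nat.exists_eq_succ_of_ne_zero (ne_of_gt hn)
      obtain ⟨a, rfl⟩ := CyclicWord.exists_periodic_eq hx
      refine ⟨WordGroup.toLimit g N (Finsupp.single a c), ?_⟩
      rw [limitMap_toLimit, Finsupp.mapDomain_single]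
      rfl

/-- One side is free on periodic orbits, the other on periodic sequences. Both sets are countably
infinite, and an arbitrary bijection between them is used. -/
theorem nonempty_equiv_wordLimit (hg : 2 ≤ g)
    (hε : ofH₁ UnitAddCircle ε = SingularChains.segment circleLine 0 1) :
    Nonempty (H₁ (MappingTorus g) ≃ₗ[ℤ] WordLimit g) := by
  have := infinite_periodicOrbit hg
  have : Infinite (PeriodicSeq g) :=
    Infinite.of_surjective (PeriodicSeq.orbit (g := g)) Quotient.mk_surjective
  obtain ⟨e⟩ := nonempty_equiv_of_countable (α := PeriodicOrbit g) (β := PeriodicSeq g)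
  exact ⟨(orbitBasis hε).repr.trans ((Finsupp.domLCongr e).trans
    (LinearEquiv.ofBijective (limitMap g) (limitMap_bijective g)).symm)⟩

theorem linearCombination_single_one {R M ι : Type*} [Semiring R] [AddCommMonoid M] [Module R M]
    (v : ι → M) (i : ι) : Finsupp.linearCombination R v (Finsupp.single i 1) = v i := by
  rw [Finsupp.linearCombination_single, one_smul]

theorem iSup_range_toH₁ (hε : ofH₁ UnitAddCircle ε = SingularChains.segment circleLine 0 1) :
    (⨆ N : ℕ, LinearMap.range (WordGroup.toH₁ (g := g) ε N)) = ⊤ := by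
  rw [eq_top_iff, ← (orbitBasis (g := g) hε).span_eq, Submodule.span_le]
  rintro _ ⟨⟨x⟩, rfl⟩
  have hpos := Function.minimalPeriod_pos_of_mem_periodicPts x.2
  obtain ⟨N, hN⟩ := Nat.exists_eq_succ_of_ne_zero hpos.ne'
  have hx : (shift g)^[N + 1] x.1 = x.1 := by
    have h := Function.isPeriodicPt_minimalPeriod (shift g) x.1
    rw [hN] at h
    exact h
  obtain ⟨a, ha⟩ := CyclicWord.exists_periodic_eq hx
  refine Submodule.mem_iSup_of_mem N ⟨Finsupp.single a 1, ?_⟩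
  refine (linearCombination_single_one _ a).trans (Eq.trans ?_ (orbitBasis_orbit hε x).symm)
  refine ofH₁_injective ?_
  rw [ofH₁_curveClass hε, orbitClass, ofH₁_curveClass hε, ha, hN]

theorem primitivePart_eq_span (hε : ofH₁ UnitAddCircle ε = SingularChains.segment circleLine 0 1)
    (N : ℕ) : primitivePart (g := g) ε N =
      Submodule.span ℤ (orbitBasis hε '' {o | o.period = N}) := by
  rw [primitivePart]
  congr 1
  ext c
  constructor
  · rintro ⟨x, hx, rfl⟩
    exact ⟨x.orbit, hx, orbitBasis_orbit hε x⟩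
  · rintro ⟨⟨x⟩, hx, rfl⟩
    exact ⟨x, hx, orbitBasis_orbit hε x⟩

/-- The exact period partitions the orbit basis, and spans of disjoint parts of a basis are
independent. -/
theorem isInternal_primitivePart
    (hε : ofH₁ UnitAddCircle ε = SingularChains.segment circleLine 0 1) :
    DirectSum.IsInternal (fun N : ℕ => primitivePart (g := g) ε N) := by
  simp only [primitivePart_eq_span hε]
  refine DirectSum.isInternal_submodule_of_iSupIndep_of_iSup_eq_top ?_ ?_
  · intro N
    refine ((orbitBasis (g := g) hε).linearIndependent.disjoint_span_image
      (s := {o | o.period = N}) (t := {o | o.period ≠ N})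
      (Set.disjoint_left.2 fun o h h' => h' h)).mono_right ?_
    refine iSup₂_le fun M hM => Submodule.span_mono (Set.image_mono fun o ho => ?_)
    rw [Set.mem_ofPred_eq] at ho ⊢
    rwa [ho]
  · rw [eq_top_iff, ← (orbitBasis (g := g) hε).span_eq, Submodule.span_le]
    rintro _ ⟨o, rfl⟩
    exact Submodule.mem_iSup_of_mem o.period (Submodule.subset_span ⟨o, rfl, rfl⟩)

/-- The span of a linearly independent family is additively a free module on it. -/
def spanAddEquiv {R M ι : Type*} [Ring R] [AddCommGroup M] [Module R M] {v : ι → M}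
    (hv : LinearIndependent R v) : Submodule.span R (Set.range v) ≃+ (ι →₀ R) :=
  (Module.Basis.span hv).repr.toAddEquiv

theorem exists_basis_span {M ι : Type} [AddCommGroup M] [Module ℤ M] {v : ι → M}
    (hv : LinearIndependent ℤ v) :
    Nonempty (Module.Basis ι ℤ (Submodule.span ℤ (Set.range v))) :=
  ⟨.ofRepr (spanAddEquiv hv).toIntLinearEquiv⟩

theorem exists_primitiveBasis
    (hε : ofH₁ UnitAddCircle ε = SingularChains.segment circleLine 0 1) (N : ℕ) :
    Nonempty (Module.Basis {o : PeriodicOrbit g // o.period = N} ℤ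
      (primitivePart (g := g) ε N)) := by
  have h := exists_basis_span ((orbitBasis hε).linearIndependent.comp
    (Subtype.val : {o : PeriodicOrbit g // o.period = N} → _) Subtype.val_injective)
  rwa [Set.range_comp, Subtype.range_coe_subtype, ← primitivePart_eq_span hε] at h

theorem finrank_primitivePart
    (hε : ofH₁ UnitAddCircle ε = SingularChains.segment circleLine 0 1) (N : ℕ) :
    Module.finrank ℤ (primitivePart (g := g) ε N) = orbitCount g N :=
  Module.finrank_eq_nat_card_basis (exists_primitiveBasis hε N).some

end SchottkyShift
end

open SchottkyShift in
theorem proposition4p14 (g : ℕ) (hg : 2 ≤ g) :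
    -- the groups `𝒦_N`, their ranks, and `H₁(𝒮_T, ℤ)` as their direct limit
    (∀ N : ℕ, Module.Free ℤ (WordGroup g N) ∧ Module.Finite ℤ (WordGroup g N) ∧
      (Even N → Module.finrank ℤ (WordGroup g N) = (2 * g - 1) ^ (N + 1) + 1) ∧
      (Odd N → Module.finrank ℤ (WordGroup g N) = (2 * g - 1) ^ (N + 1) + (2 * g - 1))) ∧
    (∀ N : ℕ, Function.Injective (WordGroup.toLimit g N)) ∧
    Nonempty (H₁ (MappingTorus g) ≃ₗ[ℤ] WordLimit g) ∧
    -- `ε` is a fundamental class of the circle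
    ∃ ε : H₁ UnitAddCircle, Submodule.span ℤ {ε} = ⊤ ∧
      -- the classes of the words generate, and satisfy `[c_{w ⋯ w}] = k [c_w]`
      (⨆ N : ℕ, LinearMap.range (WordGroup.toH₁ (g := g) ε N)) = ⊤ ∧
      (∀ (N M k : ℕ) (h : N + 1 ∣ M + 1), M + 1 = k * (N + 1) → ∀ u : WordGroup g N,
        WordGroup.toH₁ ε M (J g h u) = (k : ℤ) • WordGroup.toH₁ ε N u) ∧
      -- the decomposition into the groups `ℛ_N` and their ranks
      DirectSum.IsInternal (fun N : ℕ => primitivePart (g := g) ε N) ∧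
      (∀ N : ℕ, Module.Free ℤ (primitivePart (g := g) ε N) ∧
        Module.Finite ℤ (primitivePart (g := g) ε N)) ∧
      Module.finrank ℤ (primitivePart (g := g) ε 1) = 2 * g ∧
      Module.finrank ℤ (primitivePart (g := g) ε 2) = 2 * g * (g - 1) ∧
      (∀ N : ℕ, 2 < N →
        (Module.finrank ℤ (primitivePart (g := g) ε N) : ℚ) =
          1 / N * ∑ d ∈ N.divisors, (ArithmeticFunction.moebius d : ℚ) *
            (2 * g - 1 : ℚ) ^ (N / d)) ∧
      -- `H₁(𝒮_T, ℤ)` is free on the countably infinite set `𝒮^p / T`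
      Countable (PeriodicOrbit g) ∧ Infinite (PeriodicOrbit g) ∧
      ∃ b : Module.Basis (PeriodicOrbit g) ℤ (H₁ (MappingTorus g)),
        ∀ x : PeriodicSeq g, b x.orbit = orbitClass ε x := by
  obtain ⟨ε, hε, hspan⟩ := SingularChains.exists_fundamental_class
  refine ⟨fun N => ⟨inferInstance, inferInstance, fun hN => ?_, fun hN => ?_⟩,
    toLimit_injective g, nonempty_equiv_wordLimit hg hε, ε, hspan, iSup_range_toH₁ hε,
    toH₁_J hε, isInternal_primitivePart hε,
    fun N => ⟨Module.Free.of_basis (exists_primitiveBasis hε N).some,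
      Module.Finite.of_basis (exists_primitiveBasis hε N).some⟩, ?_, ?_, fun N hN => ?_, inferInstance,
    infinite_periodicOrbit hg, orbitBasis hε, orbitBasis_orbit hε⟩
  · rw [Module.finrank_finsupp_self, card_cyclicWord_of_even (by omega) hN]
  · rw [Module.finrank_finsupp_self, card_cyclicWord_of_odd (by omega) hN]
  · rw [finrank_primitivePart hε, orbitCount_one]
  · rw [finrank_primitivePart hε, orbitCount_two (by omega)]
  · rw [finrank_primitivePart hε, orbitCount_eq hN]
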